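/- **Setting.** Types are the argument types $\rho ::= \iota \mid \pi$ and the predicate types $\pi ::= o \mid (\rho\to\pi)$. There are countably many variables of every argument type, function symbols of every arity (constants being $0$-ary), and predicate constants of predicate types. *Positive expressions*, identified up to renaming of bound variables, are: variables; predicate constants; $\mathsf 0,\mathsf 1 : o$; terms $\mathsf f\,E_1\cdots E_n:\iota$ with $E_i:\iota$; applications $(E_1E_2):\pi$ with $E_1:\rho\to\pi$, $E_2:\rho$; $\lambda V.E:\rho\to\pi$ with $V:\rho$, $E:\pi$; $E_1\bigwedge_\pi E_2$ and $E_1\bigvee_\pi E_2$ of type $\pi$ with $E_1,E_2:\pi$; $(E_1\approx E_2):o$ with $E_i:\iota$; and $\exists V\,E:o$ with $E:o$. Write $\wedge$ for $\bigwedge_o$ and $\Box$ for $\mathsf 1$. A *program* $P$ is a set of clauses $p\leftarrow E$ with $p$ a predicate constant and $E$ a closed positive expression of the same type; a *goal* $G$ is a positive expression of type $o$. *Basic expressions* are: all expressions of type $\iota$; all predicate variables; $\mathsf 0$ and $\mathsf 1$; and all non-empty finite unions ($\bigvee_\pi$) of expressions $\lambda V_1\cdots\lambda V_n.\mathsf 0$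 or $\lambda V_1\cdots\lambda V_n.(A_1\wedge\cdots\wedge A_n)$, $n\ge 1$, of type $\rho_1\to\cdots\to\rho_n\to o$, where $A_i$ is $(V_i\approx B)$ if $V_i:\iota$; is $\mathsf 1$ or $V_i$ if $V_i:o$; and otherwise is $\mathsf 1$ or $V_i(B_{11})\cdots(B_{1r})\wedge\cdots\wedge V_i(B_{m1})\cdots(B_{mr})$ with $m>0$; here the $B$, $B_{kl}$ (the *basic subexpressions*) are basic expressions that contain none of $V_1,\dots,V_n$. A *basic template* is $\mathsf 0$, $\mathsf 1$, or such a finite union whose basic subexpressions are distinct variables, called its *template variables*. A *substitution* is a finite set of bindings $V/E$ with $E\ne V$ positive of the type of $V$; it is *basic* if all its $E$ are basic, and *zero-order* if all its $V$ have type $\iota$. Composition is written $\theta\sigma$ (first $\theta$), and $\varepsilon$ is the empty substitution. An *mgu* of two terms is a zero-order unifier $\theta$ such that every zero-order unifier is $\theta\gamma$ for some zero-order $\gamma$. *One-step derivation* $A\xrightarrow{\theta}A'$ is given by the rules (1) $p\,E_1\cdots E_n\xrightarrow{\varepsilon}E\,E_1\cdots E_n$ for $p\leftarrow E$ in $P$;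 (2) $Q\,E_1\cdots E_n\xrightarrow{\theta}(Q\,E_1\cdots E_n)\theta$ with $\theta=\{Q/B_t\}$, $Q$ a predicate variable, $B_t$ a basic template of the type of $Q$; (3) $(\lambda V.E)E_1\cdots E_n\xrightarrow{\varepsilon}(E\{V/E_1\})E_2\cdots E_n$; (4), (5) $(E'\bigvee_\pi E'')E_1\cdots E_n\xrightarrow{\varepsilon}E'\,E_1\cdots E_n$, and likewise to $E''\,E_1\cdots E_n$; (6) $(E'\bigwedge_\pi E'')E_1\cdots E_n\xrightarrow{\varepsilon}(E'\,E_1\cdots E_n)\wedge(E''\,E_1\cdots E_n)$ if $\pi\ne o$; (7), (8) $E_1\wedge E_2\xrightarrow{\theta}E_1'\wedge E_2\theta$ if $E_1\xrightarrow{\theta}E_1'$, and symmetrically; (9), (10) $\Box\wedge E\xrightarrow{\varepsilon}E$ and $E\wedge\Box\xrightarrow{\varepsilon}E$; (11) $(E_1\approx E_2)\xrightarrow{\theta}\Box$ if $\theta$ is an mgu of $E_1,E_2$; (12) $\exists V\,E\xrightarrow{\varepsilon}E$, where $V$ (the *released* variable) may be renamed. An *SLD-refutation* of $P\cup\{G\}$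 using $\theta=\theta_1\cdots\theta_n$ is a sequence $G=G_0\xrightarrow{\theta_1}G_1\cdots\xrightarrow{\theta_n}G_n=\Box$ in which the template variables of a template chosen in step $i$ and the variable released in step $i$ do not occur in $G_0,\dots,G_{i-1},\theta_1,\dots,\theta_{i-1}$. These are the template variables *introduced*, and the variables *released*, in the refutation. **Lifting Lemma.** Let $P$ be a program, $G$ a goal and $\theta$ a basic substitution, and suppose that $P\cup\{G\theta\}$ has an SLD-refutation using $\sigma$. Then $P\cup\{G\}$ has an SLD-refutation using a basic substitution $\delta$, such that for some basic substitution $\gamma$ $$G\delta\gamma=G\theta\sigma .$$ Moreover, the refutation, $\delta$ and $\gamma$ can be chosen so that $\delta\gamma\supseteq\theta\sigma$ and every variable in $\mathrm{dom}(\delta\gamma-\theta\sigma)$ is a template variable introduced, or a variable released, in the refutation of $P\cup\{G\}$; and if the variables released in the given refutation of $P\cup\{G\theta\}$ do not occur in $G$ or $\theta$ (as the convention that bound variables differ from free ones demands), they can be chosen so that, in addition, $\mathrm{dom}(\delta\gamma-\theta\sigma)$ consists of introduced template variables only. -/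

import Mathlib

universe u v

namespace HOLP

mutual
/-- Predicate types `π ::= o | ρ → π`. -/
inductive PTy : Type
  | o : PTy
  | arr : ATy → PTy → PTy
/-- Argument types `ρ ::= ι | π`. -/
inductive ATy : Type
  | i : ATy
  | pred : PTy → ATy
end

/-- The type `o`, as an argument type. -/
abbrev ATy.o : ATy := ATy.pred PTy.o

/-- Argument variables: countably many of every argument type. The variables of type `ι` are the
individual variables, those of type `pred π` the predicate variables. -/
abbrev Var : Type := ATy × ℕ

/-- The non-logical constants. Elements of `Func n` are the `n`-ary function symbols; the elements
of `Func 0` are the individual constants. -/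
structure Signature where
  Pred : PTy → Type u
  Func : ℕ → Type v

/-- Bound variables of type `ρ` in a context of enclosing binders (innermost binder first). -/
inductive BVar : List ATy → ATy → Type
  | zero {Γ : List ATy} {ρ : ATy} : BVar (ρ :: Γ) ρ
  | succ {Γ : List ATy} {ρ ρ' : ATy} (x : BVar Γ ρ) : BVar (ρ' :: Γ) ρ

/-- Positive expressions of a given type, under the enclosing binders `Γ`. Free variables are named,
bound variables are de Bruijn indices, so that α-congruent expressions are equal. -/
inductive Exp (S : Signature.{u, v}) : List ATy → ATy → Type (max u v)
  | fvar {Γ : List ATy} (ρ : ATy) (n : ℕ) : Exp S Γ ρ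
  | bvar {Γ : List ATy} {ρ : ATy} (x : BVar Γ ρ) : Exp S Γ ρ
  | pcon {Γ : List ATy} {π : PTy} (p : S.Pred π) : Exp S Γ (ATy.pred π)
  | fn {Γ : List ATy} {n : ℕ} (f : S.Func n) (a : Fin n → Exp S Γ ATy.i) : Exp S Γ ATy.i
  | zero {Γ : List ATy} : Exp S Γ ATy.o
  | one {Γ : List ATy} : Exp S Γ ATy.o
  | app {Γ : List ATy} {ρ : ATy} {π : PTy} (e : Exp S Γ (ATy.pred (PTy.arr ρ π)))
      (a : Exp S Γ ρ) : Exp S Γ (ATy.pred π)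
  | lam {Γ : List ATy} {ρ : ATy} {π : PTy} (e : Exp S (ρ :: Γ) (ATy.pred π)) :
      Exp S Γ (ATy.pred (PTy.arr ρ π))
  | and {Γ : List ATy} {π : PTy} (e₁ e₂ : Exp S Γ (ATy.pred π)) : Exp S Γ (ATy.pred π)
  | or {Γ : List ATy} {π : PTy} (e₁ e₂ : Exp S Γ (ATy.pred π)) : Exp S Γ (ATy.pred π)
  | eq {Γ : List ATy} (e₁ e₂ : Exp S Γ ATy.i) : Exp S Γ ATy.o
  | ex {Γ : List ATy} {ρ : ATy} (e : Exp S (ρ :: Γ) ATy.o) : Exp S Γ ATy.o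

variable {S : Signature.{u, v}}

/-- Lifting a renaming of bound variables under a binder. -/
def liftRen {Γ Δ : List ATy} (r : ∀ ρ, BVar Γ ρ → BVar Δ ρ) (ρ' : ATy) :
    ∀ ρ, BVar (ρ' :: Γ) ρ → BVar (ρ' :: Δ) ρ
  | _, BVar.zero => BVar.zero
  | _, BVar.succ x => BVar.succ (r _ x)

/-- There are no bound variables in the empty context. -/
def noBVar {Δ : List ATy} : ∀ ρ, BVar [] ρ → BVar Δ ρ
  | _, x => nomatch x

namespace Exp

/-- Renaming of bound variables. -/
def ren : ∀ {Γ Δ : List ATy} {τ : ATy}, (∀ ρ, BVar Γ ρ → BVar Δ ρ) → Exp S Γ τ → Exp S Δ τ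
  | _, _, _, _, fvar ρ n => fvar ρ n
  | _, _, _, r, bvar x => bvar (r _ x)
  | _, _, _, _, pcon p => pcon p
  | _, _, _, r, fn f a => fn f fun k => ren r (a k)
  | _, _, _, _, zero => zero
  | _, _, _, _, one => one
  | _, _, _, r, app e a => app (ren r e) (ren r a)
  | _, _, _, r, lam e => lam (ren (liftRen r _) e)
  | _, _, _, r, and e₁ e₂ => and (ren r e₁) (ren r e₂)
  | _, _, _, r, or e₁ e₂ => or (ren r e₁) (ren r e₂)
  | _, _, _, r, eq e₁ e₂ => eq (ren r e₁) (ren r e₂)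
  | _, _, _, r, ex e => ex (ren (liftRen r _) e)

/-- An expression without dangling bound variables, placed under the binders `Γ`. -/
def weaken {Γ : List ATy} {τ : ATy} (e : Exp S [] τ) : Exp S Γ τ :=
  ren noBVar e

/-- Lifting a simultaneous instantiation of bound variables under a binder. -/
def liftInst {Γ Δ : List ATy} (s : ∀ ρ, BVar Γ ρ → Exp S Δ ρ) (ρ' : ATy) :
    ∀ ρ, BVar (ρ' :: Γ) ρ → Exp S (ρ' :: Δ) ρ
  | _, BVar.zero => bvar BVar.zero
  | _, BVar.succ x => ren (fun _ y => BVar.succ y) (s _ x)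

/-- Simultaneous (capture-avoiding) instantiation of bound variables. -/
def inst : ∀ {Γ Δ : List ATy} {τ : ATy}, (∀ ρ, BVar Γ ρ → Exp S Δ ρ) → Exp S Γ τ → Exp S Δ τ
  | _, _, _, _, fvar ρ n => fvar ρ n
  | _, _, _, s, bvar x => s _ x
  | _, _, _, _, pcon p => pcon p
  | _, _, _, s, fn f a => fn f fun k => inst s (a k)
  | _, _, _, _, zero => zero
  | _, _, _, _, one => one
  | _, _, _, s, app e a => app (inst s e) (inst s a)
  | _, _, _, s, lam e => lam (inst (liftInst s _) e)
  | _, _, _, s, and e₁ e₂ => and (inst s e₁) (inst s e₂)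
  | _, _, _, s, or e₁ e₂ => or (inst s e₁) (inst s e₂)
  | _, _, _, s, eq e₁ e₂ => eq (inst s e₁) (inst s e₂)
  | _, _, _, s, ex e => ex (inst (liftInst s _) e)

/-- The instantiation that replaces the only bound variable by `a`. -/
def instFun {ρ' : ATy} (a : Exp S [] ρ') : ∀ ρ, BVar [ρ'] ρ → Exp S [] ρ
  | _, BVar.zero => a

/-- `e.inst1 a` is `E{V/a}`, where `e` is the body of `λV.E` or `∃V E`. -/
def inst1 {ρ τ : ATy} (e : Exp S [ρ] τ) (a : Exp S [] ρ) : Exp S [] τ :=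
  inst (instFun a) e

/-- The set of free variables. -/
def fv : ∀ {Γ : List ATy} {τ : ATy}, Exp S Γ τ → Set Var
  | _, _, fvar ρ n => {(ρ, n)}
  | _, _, bvar _ => ∅
  | _, _, pcon _ => ∅
  | _, _, fn _ a => ⋃ k, fv (a k)
  | _, _, zero => ∅
  | _, _, one => ∅
  | _, _, app e a => fv e ∪ fv a
  | _, _, lam e => fv e
  | _, _, and e₁ e₂ => fv e₁ ∪ fv e₂
  | _, _, or e₁ e₂ => fv e₁ ∪ fv e₂
  | _, _, eq e₁ e₂ => fv e₁ ∪ fv e₂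
  | _, _, ex e => fv e

/-- A named variable as an expression. -/
def ofVar {Γ : List ATy} (V : Var) : Exp S Γ V.1 := fvar V.1 V.2

end Exp

/-! ### Substitutions -/

/-- A substitution `{V₁/E₁, …, Vₙ/Eₙ}`, as a type-preserving map on variables that moves only
finitely many of them. -/
@[ext]
structure Subst (S : Signature.{u, v}) where
  toFun : ∀ V : Var, Exp S [] V.1
  finite_dom : {V : Var | toFun V ≠ Exp.ofVar V}.Finite

/-- Application `Eθ` of a substitution to an expression. -/
def Exp.subst (θ : Subst S) : ∀ {Γ : List ATy} {τ : ATy}, Exp S Γ τ → Exp S Γ τ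
  | _, _, .fvar ρ n => (θ.toFun (ρ, n)).weaken
  | _, _, .bvar x => .bvar x
  | _, _, .pcon p => .pcon p
  | _, _, .fn f a => .fn f fun k => (a k).subst θ
  | _, _, .zero => .zero
  | _, _, .one => .one
  | _, _, .app e a => .app (e.subst θ) (a.subst θ)
  | _, _, .lam e => .lam (e.subst θ)
  | _, _, .and e₁ e₂ => .and (e₁.subst θ) (e₂.subst θ)
  | _, _, .or e₁ e₂ => .or (e₁.subst θ) (e₂.subst θ)
  | _, _, .eq e₁ e₂ => .eq (e₁.subst θ) (e₂.subst θ)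
  | _, _, .ex e => .ex (e.subst θ)

namespace Subst

/-- The domain of a substitution. -/
def dom (θ : Subst S) : Set Var := {V | θ.toFun V ≠ Exp.ofVar V}

/-- The variables that occur in a substitution: its domain and the free variables of its range. -/
def vars (θ : Subst S) : Set Var := θ.dom ∪ ⋃ V ∈ θ.dom, (θ.toFun V).fv

/-- The set of bindings `V/E` of a substitution. -/
def bindings (θ : Subst S) : Set (Σ V : Var, Exp S [] V.1) :=
  {b | b.1 ∈ θ.dom ∧ b.2 = θ.toFun b.1}

/-- The identity substitution `ε`. -/
def id : Subst S where
  toFun V := Exp.ofVar V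
  finite_dom := by simp

open Classical in
/-- The substitution `{V/E}`. -/
noncomputable def single (V : Var) (E : Exp S [] V.1) : Subst S where
  toFun := Function.update (fun W => Exp.ofVar W) V E
  finite_dom := by
    refine (Set.finite_singleton V).subset fun W hW => ?_
    by_contra hne
    exact hW (Function.update_of_ne hne _ _)

/-- The composition `θσ` (first `θ`, then `σ`). -/
def comp (θ σ : Subst S) : Subst S where
  toFun V := (θ.toFun V).subst σ
  finite_dom := by
    refine (θ.finite_dom.union σ.finite_dom).subset fun V hV => ?_
    by_contra hne
    simp only [Set.mem_union, Set.mem_ofPred_eq, not_or, not_not] at hne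
    apply hV
    simp only [hne.1, Exp.ofVar, Exp.subst]
    rw [hne.2]
    rfl

/-- Zero-order substitutions bind only individual variables. -/
def IsZeroOrder (θ : Subst S) : Prop := ∀ V ∈ θ.dom, V.1 = ATy.i

/-- `θ` is a unifier of the terms `s` and `t`. -/
def IsUnifier (θ : Subst S) (s t : Exp S [] ATy.i) : Prop :=
  θ.IsZeroOrder ∧ s.subst θ = t.subst θ

/-- `θ` is a most general unifier of the terms `s` and `t`. -/
def IsMGU (θ : Subst S) (s t : Exp S [] ATy.i) : Prop :=
  θ.IsUnifier s t ∧ ∀ σ : Subst S, σ.IsUnifier s t → ∃ γ : Subst S, γ.IsZeroOrder ∧ σ = θ.comp γ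

end Subst

/-! ### Basic expressions and basic templates

The predicates below relate an expression of the required shape to the list of its basic
subexpressions. Being weakened from the empty context, a basic subexpression does not contain the
variables bound by the `λ`s around it. Finite conjunctions and unions may be bracketed in any way.
-/

/-- Lists of closed-context expressions of arbitrary types. -/
abbrev ExpList (S : Signature.{u, v}) := List (Σ ρ : ATy, Exp S [] ρ)

/-- `V(B₁)⋯(Bᵣ)`, for a bound variable `V`. -/
inductive IsCall {Γ : List ATy} {π₀ : PTy} (x : BVar Γ (ATy.pred π₀)) :
    ∀ {π : PTy}, Exp S Γ (ATy.pred π) → ExpList S → Prop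
  | head : IsCall x (Exp.bvar x) []
  | app {ρ : ATy} {π : PTy} {e : Exp S Γ (ATy.pred (PTy.arr ρ π))} {L : ExpList S}
      (h : IsCall x e L) (B : Exp S [] ρ) : IsCall x (Exp.app e B.weaken) (L ++ [⟨ρ, B⟩])

/-- `V(B₁₁)⋯(B₁ᵣ) ∧ ⋯ ∧ V(Bₘ₁)⋯(Bₘᵣ)` with `m > 0`, of type `o`. -/
inductive IsCalls {Γ : List ATy} {π₀ : PTy} (x : BVar Γ (ATy.pred π₀)) :
    Exp S Γ ATy.o → ExpList S → Prop
  | single {e : Exp S Γ ATy.o} {L : ExpList S} (h : IsCall x e L) : IsCalls x e L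
  | and {e₁ e₂ : Exp S Γ ATy.o} {L₁ L₂ : ExpList S} (h₁ : IsCalls x e₁ L₁)
      (h₂ : IsCalls x e₂ L₂) : IsCalls x (Exp.and e₁ e₂) (L₁ ++ L₂)

/-- The conjunct `Aᵢ` that belongs to the `λ`-bound variable `Vᵢ`. -/
inductive IsConjunct {Γ : List ATy} : ∀ {ρ : ATy}, BVar Γ ρ → Exp S Γ ATy.o → ExpList S → Prop
  | eq (x : BVar Γ ATy.i) (B : Exp S [] ATy.i) :
      IsConjunct x (Exp.eq (Exp.bvar x) B.weaken) [⟨ATy.i, B⟩]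
  | one {π : PTy} (x : BVar Γ (ATy.pred π)) : IsConjunct x Exp.one []
  | prop (x : BVar Γ ATy.o) : IsConjunct x (Exp.bvar x) []
  | calls {π : PTy} (x : BVar Γ (ATy.pred π)) (hπ : π ≠ PTy.o) {e : Exp S Γ ATy.o} {L : ExpList S}
      (h : IsCalls x e L) : IsConjunct x e L

/-- A conjunction of one conjunct for each of the listed bound variables, in that order. -/
inductive IsConj {Γ : List ATy} :
    List (Σ ρ : ATy, BVar Γ ρ) → Exp S Γ ATy.o → ExpList S → Prop
  | single {ρ : ATy} {x : BVar Γ ρ} {e : Exp S Γ ATy.o} {L : ExpList S} (h : IsConjunct x e L) :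
      IsConj [⟨ρ, x⟩] e L
  | and {xs ys : List (Σ ρ : ATy, BVar Γ ρ)} {e₁ e₂ : Exp S Γ ATy.o} {L₁ L₂ : ExpList S}
      (h₁ : IsConj xs e₁ L₁) (h₂ : IsConj ys e₂ L₂) :
      IsConj (xs ++ ys) (Exp.and e₁ e₂) (L₁ ++ L₂)

/-- All bound variables `V₁, …, Vₙ` of a context, the outermost first. -/
def allBVars : ∀ Γ : List ATy, List (Σ ρ : ATy, BVar Γ ρ)
  | [] => []
  | ρ :: Γ => (allBVars Γ).map (fun x => ⟨x.1, BVar.succ x.2⟩) ++ [⟨ρ, BVar.zero⟩]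

/-- In the empty context: `λV₁.⋯λVₙ.0` or `λV₁.⋯λVₙ.(A₁ ∧ ⋯ ∧ Aₙ)`, with `n > 0`. In the context
`Γ`: such an expression with its outer `λ`s, those for `Γ`, removed. -/
inductive IsStepExp : ∀ {Γ : List ATy} {π : PTy}, Exp S Γ (ATy.pred π) → ExpList S → Prop
  | bot {Γ : List ATy} (hΓ : Γ ≠ []) : IsStepExp (Exp.zero : Exp S Γ ATy.o) []
  | conj {Γ : List ATy} {e : Exp S Γ ATy.o} {L : ExpList S} (h : IsConj (allBVars Γ) e L) :
      IsStepExp e L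
  | lam {Γ : List ATy} {ρ : ATy} {π : PTy} {e : Exp S (ρ :: Γ) (ATy.pred π)} {L : ExpList S}
      (h : IsStepExp e L) : IsStepExp (Exp.lam e) L

/-- Non-empty finite unions of expressions of the above form. -/
inductive IsUnionExp {π : PTy} : Exp S [] (ATy.pred π) → ExpList S → Prop
  | single {e : Exp S [] (ATy.pred π)} {L : ExpList S} (h : IsStepExp e L) : IsUnionExp e L
  | or {e₁ e₂ : Exp S [] (ATy.pred π)} {L₁ L₂ : ExpList S} (h₁ : IsUnionExp e₁ L₁)
      (h₂ : IsUnionExp e₂ L₂) : IsUnionExp (Exp.or e₁ e₂) (L₁ ++ L₂)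

/-- Basic expressions. -/
inductive IsBasic : ∀ {ρ : ATy}, Exp S [] ρ → Prop
  | term (t : Exp S [] ATy.i) : IsBasic t
  | var (π : PTy) (n : ℕ) : IsBasic (Exp.fvar (ATy.pred π) n)
  | zero : IsBasic Exp.zero
  | one : IsBasic Exp.one
  | union {π : PTy} {e : Exp S [] (ATy.pred π)} {L : ExpList S} (h : IsUnionExp e L)
      (hL : ∀ b ∈ L, IsBasic b.2) : IsBasic e

/-- `IsTemplate e T`: the expression `e` is a basic template, with template variables `T`. -/
inductive IsTemplate : ∀ {π : PTy}, Exp S [] (ATy.pred π) → List Var → Prop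
  | zero : IsTemplate Exp.zero []
  | one : IsTemplate Exp.one []
  | union {π : PTy} {e : Exp S [] (ATy.pred π)} {T : List Var} (hT : T.Nodup)
      (h : IsUnionExp e (T.map fun V => ⟨V.1, Exp.ofVar V⟩)) : IsTemplate e T

/-- Basic substitutions. -/
def Subst.IsBasic (θ : Subst S) : Prop := ∀ V ∈ θ.dom, HOLP.IsBasic (θ.toFun V)

/-! ### Programs and SLD-resolution -/

/-- A program clause `p ← E`, with `E` closed. -/
structure Clause (S : Signature.{u, v}) where
  ty : PTy
  head : S.Pred ty
  body : Exp S [] (ATy.pred ty)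
  closed : body.fv = ∅

/-- A program is a set of program clauses. -/
abbrev Program (S : Signature.{u, v}) := Set (Clause S)

/-- A goal `← A` is given by the formula `A`. The empty clause `□` is `Exp.one`. -/
abbrev Goal (S : Signature.{u, v}) := Exp S [] ATy.o

/-- Argument lists `E₁, …, Eₙ` for an expression of type `ρ₁ → ⋯ → ρₙ → o`. -/
inductive Args (S : Signature.{u, v}) : PTy → Type (max u v)
  | nil : Args S PTy.o
  | cons {ρ : ATy} {π : PTy} (a : Exp S [] ρ) (as : Args S π) : Args S (PTy.arr ρ π)

/-- The formula `E E₁ ⋯ Eₙ`. -/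
def Exp.apps : ∀ {π : PTy}, Exp S [] (ATy.pred π) → Args S π → Goal S
  | _, e, .nil => e
  | _, e, .cons a as => (Exp.app e a).apps as

/-- `Step P A θ T R A'`: the formula `A'` is derived in one step from `A` using `θ`. Here `T` lists
the template variables of the basic template chosen in the step (if any) and `R` the variable that is
released in the step from an existential quantifier (if any). That these are new is required in
`Derivation`. -/
inductive Step (P : Program S) : Goal S → Subst S → List Var → List Var → Goal S → Prop
  | clause (C : Clause S) (hC : C ∈ P) (as : Args S C.ty) :
      Step P ((Exp.pcon C.head).apps as) Subst.id [] [] (C.body.apps as)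
  | template {π : PTy} (Q : ℕ) (as : Args S π) (B : Exp S [] (ATy.pred π)) (T : List Var)
      (hB : IsTemplate B T) :
      Step P ((Exp.fvar (ATy.pred π) Q).apps as) (Subst.single (ATy.pred π, Q) B) T []
        (((Exp.fvar (ATy.pred π) Q).apps as).subst (Subst.single (ATy.pred π, Q) B))
  | beta {ρ : ATy} {π : PTy} (E : Exp S [ρ] (ATy.pred π)) (a : Exp S [] ρ) (as : Args S π) :
      Step P ((Exp.lam E).apps (Args.cons a as)) Subst.id [] [] ((E.inst1 a).apps as)
  | orLeft {π : PTy} (E₁ E₂ : Exp S [] (ATy.pred π)) (as : Args S π) :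
      Step P ((Exp.or E₁ E₂).apps as) Subst.id [] [] (E₁.apps as)
  | orRight {π : PTy} (E₁ E₂ : Exp S [] (ATy.pred π)) (as : Args S π) :
      Step P ((Exp.or E₁ E₂).apps as) Subst.id [] [] (E₂.apps as)
  | andApp {π : PTy} (hπ : π ≠ PTy.o) (E₁ E₂ : Exp S [] (ATy.pred π)) (as : Args S π) :
      Step P ((Exp.and E₁ E₂).apps as) Subst.id [] [] (Exp.and (E₁.apps as) (E₂.apps as))
  | andLeft {A A' : Goal S} {θ : Subst S} {T R : List Var} (B : Goal S) (h : Step P A θ T R A') :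
      Step P (Exp.and A B) θ T R (Exp.and A' (B.subst θ))
  | andRight {B B' : Goal S} {θ : Subst S} {T R : List Var} (A : Goal S) (h : Step P B θ T R B') :
      Step P (Exp.and A B) θ T R (Exp.and (A.subst θ) B')
  | oneAnd (A : Goal S) : Step P (Exp.and Exp.one A) Subst.id [] [] A
  | andOne (A : Goal S) : Step P (Exp.and A Exp.one) Subst.id [] [] A
  | eq (s t : Exp S [] ATy.i) (θ : Subst S) (hθ : θ.IsMGU s t) :
      Step P (Exp.eq s t) θ [] [] Exp.one
  | ex {ρ : ATy} (E : Exp S [ρ] ATy.o) (n : ℕ) :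
      Step P (Exp.ex E) Subst.id [] [(ρ, n)] (E.inst1 (Exp.fvar ρ n))

/-- `Derivation P U A θ T R A'`: a finite SLD-derivation from `A` to `A'` whose substitutions
compose to `θ`, which introduces the template variables `T` and releases the existential variables
`R`, where `U` is the set of variables that appeared before `A`. In every step the variables
introduced must not have appeared (in a goal or in a substitution) so far. For the released variables
this is the convention that bound variables are chosen different from the free ones. -/
inductive Derivation (P : Program S) :
    Set Var → Goal S → Subst S → List Var → List Var → Goal S → Prop
  | refl (U : Set Var) (A : Goal S) : Derivation P U A Subst.id [] [] A
  | step {U : Set Var} {A A₁ A' : Goal S} {θ θ' : Subst S} {T T' R R' : List Var}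
      (h : Step P A θ T R A₁) (hT : ∀ V ∈ T, V ∉ U ∪ A.fv) (hR : ∀ V ∈ R, V ∉ U ∪ A.fv)
      (h' : Derivation P (U ∪ A.fv ∪ θ.vars) A₁ θ' T' R' A') :
      Derivation P U A (θ.comp θ') (T ++ T') (R ++ R') A'

/-- An SLD-refutation of `P ∪ {G}` using `θ`, with the template variables `T` and the existential
variables `R` introduced in it. -/
def IsRefutation (P : Program S) (G : Goal S) (θ : Subst S) (T R : List Var) : Prop :=
  Derivation P ∅ G θ T R Exp.one

end HOLP

-- The given refutation is lifted step by step. The invariant is that the given goal is an instance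
-- `Aθ` of the lifted goal `A`, with `θ` basic. Basic expressions are never applications,
-- conjunctions, equations or existential formulas, so where `Aθ` has one of these forms, `A` has it
-- already. The only thing that `θ` can supply is the expression at the head of a formula `E E₁ ⋯
-- Eₙ`, when the head of `A` is a predicate variable `Q`. If `θ(Q)` is not a variable, it is an
-- instance of a basic template with fresh template variables (`IsBasic.exists_template`). An
-- additional template step binds `Q` to that template, `θ` is extended by the values of the
-- template variables, and the step can then be imitated. If `θ(Q)` is a variable, the given step is
-- itself a template step, and it is imitated with a renamed template. Templates are also inserted
-- when a variable has the value `1`, in `□ ∧ E`, in `E ∧ □` and at the very end.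
--
-- For an equation, `θθ₁` solves the lifted equation but need not be zero-order, so the defining
-- property of an mgu does not apply to it. Unification is therefore carried out anew, giving a
-- zero-order `μ` with `μσ = σ` for every solution `σ`, zero-order or not (`exists_isStrongMGU`).
--
-- Each lifted step `δ` comes with a new `θ'` such that `δθ'` and `θθ₁` agree off the variables
-- introduced. Composing these agreements (`Lifts.cons`) yields `δγ` and `θσ` that agree off the
-- introduced variables. These are chosen outside the variables of `G` and the domain of `θσ`, and
-- all claims about bindings follow.
--
-- The proposition `K` stands for the convention on released variables and lets one induction serve
-- both versions of the last claim. Under `K` the lifted refutation releases the very same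
-- variables, at which agreement holds as well; otherwise it releases fresh ones, at which agreement
-- is not claimed.

namespace HOLP

variable {S : Signature.{u, v}}

-- Renaming, instantiation and substitution

namespace Exp

theorem liftRen_comp {Γ Δ Θ : List ATy} (r : ∀ ρ, BVar Γ ρ → BVar Δ ρ)
    (r' : ∀ ρ, BVar Δ ρ → BVar Θ ρ) (ρ' : ATy) :
    (fun ρ x => liftRen r' ρ' ρ (liftRen r ρ' ρ x)) = liftRen (fun ρ x => r' ρ (r ρ x)) ρ' := by
  funext ρ x
  cases x <;> rfl

theorem ren_ren {Γ : List ATy} {τ : ATy} (e : Exp S Γ τ) : ∀ {Δ Θ : List ATy}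
    (r : ∀ ρ, BVar Γ ρ → BVar Δ ρ) (r' : ∀ ρ, BVar Δ ρ → BVar Θ ρ),
    ren r' (ren r e) = ren (fun ρ x => r' ρ (r ρ x)) e := by
  induction e <;> intros <;> simp_all [-IsEmpty.forall_iff, ren, liftRen_comp]

theorem noBVar_unique {Δ : List ATy} (r : ∀ ρ, BVar [] ρ → BVar Δ ρ) : r = noBVar := by
  funext ρ x
  cases x

theorem ren_weaken {Γ Δ : List ATy} {τ : ATy} (r : ∀ ρ, BVar Γ ρ → BVar Δ ρ) (e : Exp S [] τ) :
    ren r (weaken e) = weaken e := by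
  rw [weaken, ren_ren, noBVar_unique fun ρ x => r ρ (noBVar ρ x)]
  rfl

theorem liftRen_id {Γ : List ATy} (ρ' : ATy) :
    liftRen (fun (ρ : ATy) (x : BVar Γ ρ) => x) ρ' = fun _ x => x := by
  funext ρ x
  cases x <;> rfl

theorem ren_id {Γ : List ATy} {τ : ATy} (e : Exp S Γ τ) : ren (fun _ x => x) e = e := by
  induction e <;> simp_all [-IsEmpty.forall_iff, ren, liftRen_id]

@[simp]
theorem weaken_nil {τ : ATy} (e : Exp S [] τ) : (weaken e : Exp S [] τ) = e := by
  rw [weaken, ← noBVar_unique fun _ x => x, ren_id]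

theorem fv_ren {Γ : List ATy} {τ : ATy} (e : Exp S Γ τ) : ∀ {Δ : List ATy}
    (r : ∀ ρ, BVar Γ ρ → BVar Δ ρ), (ren r e).fv = e.fv := by
  induction e <;> intros <;> simp_all [-IsEmpty.forall_iff, ren, fv]

@[simp]
theorem fv_weaken {Γ : List ATy} {τ : ATy} (e : Exp S [] τ) :
    (weaken e : Exp S Γ τ).fv = e.fv :=
  fv_ren e _

@[simp]
theorem fv_ofVar {Γ : List ATy} (V : Var) : (ofVar V : Exp S Γ V.1).fv = {V} := rfl

theorem fv_finite {Γ : List ATy} {τ : ATy} (e : Exp S Γ τ) : e.fv.Finite := by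
  induction e <;> simp_all [-IsEmpty.forall_iff, fv, Set.finite_iUnion]

theorem subst_ren (θ : Subst S) {Γ : List ATy} {τ : ATy} (e : Exp S Γ τ) : ∀ {Δ : List ATy}
    (r : ∀ ρ, BVar Γ ρ → BVar Δ ρ), (ren r e).subst θ = ren r (e.subst θ) := by
  induction e <;> intros <;> simp_all [-IsEmpty.forall_iff, ren, subst, ren_weaken]

theorem subst_weaken (θ : Subst S) {Γ : List ATy} {τ : ATy} (e : Exp S [] τ) :
    (weaken e : Exp S Γ τ).subst θ = weaken (e.subst θ) :=
  subst_ren θ e _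

theorem subst_subst (θ σ : Subst S) {Γ : List ATy} {τ : ATy} (e : Exp S Γ τ) :
    (e.subst θ).subst σ = e.subst (θ.comp σ) := by
  induction e <;> simp_all [-IsEmpty.forall_iff, subst, subst_weaken, Subst.comp]

theorem subst_congr {θ σ : Subst S} {Γ : List ATy} {τ : ATy} {e : Exp S Γ τ}
    (h : ∀ V ∈ e.fv, θ.toFun V = σ.toFun V) : e.subst θ = e.subst σ := by
  induction e with
  | fn f a ih =>
    simp only [subst, fn.injEq, heq_eq_eq, true_and]
    funext k
    exact ih k fun V hV => h V (Set.mem_iUnion.2 ⟨k, hV⟩)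
  | _ => simp_all [-IsEmpty.forall_iff, subst, fv]

@[simp]
theorem subst_id {Γ : List ATy} {τ : ATy} (e : Exp S Γ τ) : e.subst Subst.id = e := by
  induction e <;> simp_all [-IsEmpty.forall_iff, subst, Subst.id, ofVar, weaken, ren]

theorem subst_of_fv_eq_empty {θ : Subst S} {Γ : List ATy} {τ : ATy} {e : Exp S Γ τ}
    (h : e.fv = ∅) : e.subst θ = e := by
  conv_rhs => rw [← subst_id e]
  exact subst_congr (by simp [h])

theorem subst_ofVar (θ : Subst S) (V : Var) : (ofVar V : Exp S [] V.1).subst θ = θ.toFun V :=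
  weaken_nil _

theorem fv_subst (θ : Subst S) {Γ : List ATy} {τ : ATy} (e : Exp S Γ τ) :
    (e.subst θ).fv = ⋃ V ∈ e.fv, (θ.toFun V).fv := by
  induction e with
  | fn f a ih =>
    simp only [subst, fv, ih]
    ext V
    simp only [Set.mem_iUnion, exists_prop]
    grind
  | _ => simp_all [-IsEmpty.forall_iff, subst, fv, Set.iUnion_or, Set.iUnion_union_distrib]

theorem liftInst_bvar {Γ Δ : List ATy} (r : ∀ ρ, BVar Γ ρ → BVar Δ ρ) (ρ' : ATy) :
    liftInst (fun ρ x => (bvar (r ρ x) : Exp S Δ ρ)) ρ' = fun ρ x => bvar (liftRen r ρ' ρ x) := by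
  funext ρ x
  cases x <;> rfl

theorem inst_bvar {Γ : List ATy} {τ : ATy} (e : Exp S Γ τ) : ∀ {Δ : List ATy}
    (r : ∀ ρ, BVar Γ ρ → BVar Δ ρ), inst (fun ρ x => bvar (r ρ x)) e = ren r e := by
  induction e <;> intros <;> simp_all [-IsEmpty.forall_iff, ren, inst, liftInst_bvar]

theorem liftInst_liftRen {Γ Δ Θ : List ATy} (r : ∀ ρ, BVar Γ ρ → BVar Δ ρ)
    (s : ∀ ρ, BVar Δ ρ → Exp S Θ ρ) (ρ' : ATy) :
    (fun ρ x => liftInst s ρ' ρ (liftRen r ρ' ρ x)) = liftInst (fun ρ x => s ρ (r ρ x)) ρ' := by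
  funext ρ x
  cases x <;> rfl

theorem inst_ren {Γ : List ATy} {τ : ATy} (e : Exp S Γ τ) : ∀ {Δ Θ : List ATy}
    (r : ∀ ρ, BVar Γ ρ → BVar Δ ρ) (s : ∀ ρ, BVar Δ ρ → Exp S Θ ρ),
    inst s (ren r e) = inst (fun ρ x => s ρ (r ρ x)) e := by
  induction e <;> intros <;> simp_all [-IsEmpty.forall_iff, ren, inst, liftInst_liftRen]

theorem inst_weaken {Γ Δ : List ATy} {τ : ATy} (s : ∀ ρ, BVar Γ ρ → Exp S Δ ρ) (e : Exp S [] τ) :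
    inst s (weaken e) = weaken e := by
  rw [weaken, inst_ren, weaken, ← inst_bvar]
  congr 1
  funext ρ x
  cases x

theorem liftInst_subst (θ : Subst S) {Γ Δ : List ATy} (s : ∀ ρ, BVar Γ ρ → Exp S Δ ρ) (ρ' : ATy) :
    (fun ρ x => (liftInst s ρ' ρ x).subst θ) = liftInst (fun ρ x => (s ρ x).subst θ) ρ' := by
  funext ρ x
  cases x with
  | zero => rfl
  | succ x => simp [liftInst, subst_ren]

/-- The values of `θ` contain no bound variables, so instantiation leaves them alone. This is what
makes β-steps and releases commute with `θ`. -/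
theorem subst_inst (θ : Subst S) {Γ : List ATy} {τ : ATy} (e : Exp S Γ τ) : ∀ {Δ : List ATy}
    (s : ∀ ρ, BVar Γ ρ → Exp S Δ ρ),
    (inst s e).subst θ = inst (fun ρ x => (s ρ x).subst θ) (e.subst θ) := by
  induction e <;> intros <;>
    simp_all [-IsEmpty.forall_iff, inst, subst, inst_weaken, liftInst_subst]

theorem subst_inst1 (θ : Subst S) {ρ τ : ATy} (e : Exp S [ρ] τ) (a : Exp S [] ρ) :
    (e.inst1 a).subst θ = (e.subst θ).inst1 (a.subst θ) := by
  rw [inst1, subst_inst, inst1]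
  congr 1
  funext ρ x
  cases x with
  | zero => rfl
  | succ x => cases x

theorem fv_inst_subset {Γ : List ATy} {τ : ATy} (e : Exp S Γ τ) : ∀ {Δ : List ATy}
    (s : ∀ ρ, BVar Γ ρ → Exp S Δ ρ) (X : Set Var), (∀ ρ x, (s ρ x).fv ⊆ X) →
    (inst s e).fv ⊆ e.fv ∪ X := by
  have lift : ∀ {Γ Δ : List ATy} (s : ∀ ρ, BVar Γ ρ → Exp S Δ ρ) (X : Set Var) (ρ' : ATy),
      (∀ ρ x, (s ρ x).fv ⊆ X) → ∀ ρ x, (liftInst s ρ' ρ x).fv ⊆ X := by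
    intro Γ Δ s X ρ' h ρ x
    cases x with
    | zero => simp [liftInst, fv]
    | succ x => simpa [liftInst, fv_ren] using h _ x
  induction e with
  | fn f a ih =>
    intro Δ s X h
    simp only [inst, fv, Set.iUnion_subset_iff]
    exact fun k => (ih k s X h).trans
      (Set.union_subset_union_left _ (Set.subset_iUnion (fun k => (a k).fv) k))
  | bvar x => intro Δ s X h; simpa [inst, fv] using h _ x
  | lam e ih => intro Δ s X h; exact ih _ X (lift s X _ h)
  | ex e ih => intro Δ s X h; exact ih _ X (lift s X _ h)
  | app e₁ e₂ ih₁ ih₂ | and e₁ e₂ ih₁ ih₂ | or e₁ e₂ ih₁ ih₂ | eq e₁ e₂ ih₁ ih₂ =>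
    intro Δ s X h
    have h₁ := ih₁ s X h
    have h₂ := ih₂ s X h
    simp only [inst, fv]
    grind
  | _ => intros; simp [inst, fv]

/-- Only an inclusion, since a vacuous binder discards `a`. -/
theorem fv_inst1_subset {ρ τ : ATy} (e : Exp S [ρ] τ) (a : Exp S [] ρ) :
    (e.inst1 a).fv ⊆ e.fv ∪ a.fv := by
  refine fv_inst_subset e _ _ fun ρ x => ?_
  cases x with
  | zero => exact subset_rfl
  | succ x => cases x

end Exp

-- Composition and modification of substitutions

namespace Subst

theorem comp_assoc (θ σ τ : Subst S) : (θ.comp σ).comp τ = θ.comp (σ.comp τ) := by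
  ext V
  exact Exp.subst_subst σ τ _

@[simp]
theorem comp_id (θ : Subst S) : θ.comp Subst.id = θ := by
  ext V
  exact Exp.subst_id _

@[simp]
theorem id_comp (θ : Subst S) : Subst.id.comp θ = θ := by
  ext V
  exact Exp.subst_ofVar θ V

@[simp]
theorem single_self (V : Var) (E : Exp S [] V.1) : (single V E).toFun V = E := by
  simp [single]

theorem single_of_ne {V W : Var} (E : Exp S [] V.1) (h : W ≠ V) :
    (single V E).toFun W = Exp.ofVar W := by
  simp [single, h]

theorem dom_single_subset (V : Var) (E : Exp S [] V.1) : (single V E).dom ⊆ {V} := by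
  intro W hW
  by_contra h
  exact hW (single_of_ne E h)

theorem vars_single_subset (V : Var) (E : Exp S [] V.1) : (single V E).vars ⊆ {V} ∪ E.fv := by
  rintro W (hW | hW)
  · exact Or.inl (dom_single_subset V E hW)
  · simp only [Set.mem_iUnion] at hW
    obtain ⟨X, hX, hW⟩ := hW
    cases dom_single_subset V E hX
    rw [single_self] at hW
    exact Or.inr hW

theorem dom_id : (Subst.id : Subst S).dom = ∅ := by
  simp [dom, Subst.id]

theorem vars_id : (Subst.id : Subst S).vars = ∅ := by
  simp [vars, dom_id]

theorem vars_finite (θ : Subst S) : θ.vars.Finite :=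
  θ.finite_dom.union (θ.finite_dom.biUnion fun _ _ => Exp.fv_finite _)

theorem fv_toFun_subset (θ : Subst S) (V : Var) : (θ.toFun V).fv ⊆ {V} ∪ θ.vars := by
  intro W hW
  by_cases h : V ∈ θ.dom
  · exact Or.inr (Or.inr (Set.mem_biUnion h hW))
  · simp only [dom, Set.mem_ofPred_eq, not_not] at h
    rw [h] at hW
    exact Or.inl hW

theorem dom_comp_subset (θ σ : Subst S) : (θ.comp σ).dom ⊆ θ.dom ∪ σ.dom := by
  intro V hV
  by_contra h
  simp only [dom, Set.mem_union, Set.mem_ofPred_eq, not_or, not_not] at h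
  refine hV ?_
  change (θ.toFun V).subst σ = _
  rw [h.1, Exp.subst_ofVar, h.2]

theorem vars_comp_subset (θ σ : Subst S) : (θ.comp σ).vars ⊆ θ.vars ∪ σ.vars := by
  rintro W (hW | hW)
  · rcases dom_comp_subset θ σ hW with h | h
    · exact Or.inl (Or.inl h)
    · exact Or.inr (Or.inl h)
  · simp only [Set.mem_iUnion] at hW
    obtain ⟨V, hV, hW⟩ := hW
    change W ∈ ((θ.toFun V).subst σ).fv at hW
    simp only [Exp.fv_subst, Set.mem_iUnion] at hW
    obtain ⟨X, hX, hW⟩ := hW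
    rcases σ.fv_toFun_subset X hW with rfl | h
    · rcases θ.fv_toFun_subset V hX with rfl | h
      · rcases dom_comp_subset θ σ hV with h | h
        · exact Or.inl (Or.inl h)
        · exact Or.inr (Or.inl h)
      · exact Or.inl h
    · exact Or.inr h

open Classical in
/-- The substitution that agrees with `ξ` on the variables listed in `T`, and with `θ` elsewhere. -/
noncomputable def override (θ : Subst S) (T : List Var) (ξ : ∀ V : Var, Exp S [] V.1) :
    Subst S where
  toFun V := if V ∈ T then ξ V else θ.toFun V
  finite_dom := by
    refine (θ.finite_dom.union T.finite_toSet).subset fun V hV => ?_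
    by_cases h : V ∈ T
    · exact Or.inr h
    · exact Or.inl (by simpa [h] using hV)

theorem override_of_mem (θ : Subst S) {T : List Var} (ξ : ∀ V : Var, Exp S [] V.1) {V : Var}
    (h : V ∈ T) : (θ.override T ξ).toFun V = ξ V := by
  simp [override, h]

theorem override_of_notMem (θ : Subst S) {T : List Var} (ξ : ∀ V : Var, Exp S [] V.1) {V : Var}
    (h : V ∉ T) : (θ.override T ξ).toFun V = θ.toFun V := by
  simp [override, h]

theorem dom_override_subset (θ : Subst S) (T : List Var) (ξ : ∀ V : Var, Exp S [] V.1) :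
    (θ.override T ξ).dom ⊆ θ.dom ∪ {V | V ∈ T} := by
  intro V hV
  by_cases h : V ∈ T
  · exact Or.inr h
  · refine Or.inl ?_
    rwa [dom, Set.mem_ofPred_eq, override_of_notMem θ ξ h] at hV

end Subst

-- Unification of terms

namespace Exp

/-- The number of variable and function symbol occurrences in a term. -/
def size : ∀ {Γ : List ATy} {τ : ATy}, Exp S Γ τ → ℕ
  | _, _, fn _ a => 1 + ∑ k, size (a k)
  | _, _, _ => 1

theorem size_pos (t : Exp S [] ATy.i) : 0 < t.size := by
  cases t <;> simp [size]

theorem size_lt_fn {n : ℕ} (f : S.Func n) (a : Fin n → Exp S [] ATy.i) (k : Fin n) :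
    (a k).size < (fn f a).size := by
  have := Finset.single_le_sum (f := fun k => (a k).size) (fun _ _ => Nat.zero_le _)
    (Finset.mem_univ k)
  simp only [size] at *
  omega

/-- An induction principle for terms. -/
theorem term_induction {motive : Exp S [] ATy.i → Prop}
    (var : ∀ n, motive (fvar ATy.i n))
    (fn : ∀ {n} (f : S.Func n) (a : Fin n → Exp S [] ATy.i), (∀ k, motive (a k)) → motive (fn f a))
    (t : Exp S [] ATy.i) : motive t := by
  induction h : t.size using Nat.strong_induction_on generalizing t with
  | _ m ih =>
    subst h
    cases t with
    | fvar _ n => exact var n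
    | bvar x => cases x
    | fn f a => exact fn f a fun k => ih _ (size_lt_fn f a k) _ rfl

/-- Every variable of a term is an individual variable, and its instance is no larger than that of
the term. -/
theorem size_toFun_le_size_subst (σ : Subst S) (t : Exp S [] ATy.i) {V : Var} (hV : V ∈ t.fv) :
    V.1 = ATy.i ∧ (σ.toFun V).size ≤ (t.subst σ).size := by
  induction t using term_induction with
  | var n =>
    cases hV
    simp [subst]
  | fn f a ih =>
    obtain ⟨k, hk⟩ := Set.mem_iUnion.1 hV
    exact ⟨(ih k hk).1, (ih k hk).2.trans (size_lt_fn f (fun k => (a k).subst σ) k).le⟩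

/-- The occurs check. -/
theorem toFun_ne_subst_of_mem_fv (σ : Subst S) (n : ℕ) (t : Exp S [] ATy.i)
    (ht : t ≠ fvar ATy.i n) (hn : (ATy.i, n) ∈ t.fv) : σ.toFun (ATy.i, n) ≠ t.subst σ := by
  intro h
  cases t with
  | fvar _ m =>
    cases hn
    exact ht rfl
  | bvar x => cases x
  | fn f a =>
    obtain ⟨k, hk⟩ := Set.mem_iUnion.1 hn
    have h₁ := (size_toFun_le_size_subst σ (a k) hk).2
    have h₂ := size_lt_fn f (fun k => (a k).subst σ) k
    rw [h] at h₁
    simp only [subst] at h₁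
    omega

end Exp

/-- The variables of a system of equations between terms. -/
def eqsVars (l : List (Exp S [] ATy.i × Exp S [] ATy.i)) : Set Var :=
  {V | ∃ p ∈ l, V ∈ p.1.fv ∨ V ∈ p.2.fv}

/-- The total size of a system of equations between terms. -/
def eqsSize (l : List (Exp S [] ATy.i × Exp S [] ATy.i)) : ℕ :=
  (l.map fun p => p.1.size + p.2.size).sum

theorem eqsVars_finite (l : List (Exp S [] ATy.i × Exp S [] ATy.i)) : (eqsVars l).Finite := by
  refine (l.finite_toSet.biUnion fun p _ => p.1.fv_finite.union p.2.fv_finite).subset ?_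
  rintro V ⟨p, hp, hV⟩
  exact Set.mem_biUnion hp hV

/-- `σ` solves the system `l` of equations; it need not be zero-order. -/
def Solves (σ : Subst S) (l : List (Exp S [] ATy.i × Exp S [] ATy.i)) : Prop :=
  ∀ p ∈ l, p.1.subst σ = p.2.subst σ

/-- `μ` is a zero-order solution of `l`, built from the variables of `l`, through which every
solution `σ` factors as `μσ`. -/
structure IsStrongMGU (μ : Subst S) (l : List (Exp S [] ATy.i × Exp S [] ATy.i)) : Prop where
  zeroOrder : μ.IsZeroOrder
  solves : Solves μ l
  vars_subset : μ.vars ⊆ eqsVars l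
  comp_eq : ∀ σ : Subst S, Solves σ l → μ.comp σ = σ

theorem solves_cons {σ : Subst S} {p : Exp S [] ATy.i × Exp S [] ATy.i}
    {l : List (Exp S [] ATy.i × Exp S [] ATy.i)} :
    Solves σ (p :: l) ↔ p.1.subst σ = p.2.subst σ ∧ Solves σ l := by
  simp [Solves]

/-- A substitution that already solves the equation `V = t` does not notice that `V` is first
replaced by `t`. This absorption is the source of `μσ = σ`. -/
theorem Subst.single_comp_of_eq {σ : Subst S} {V : Var} {t : Exp S [] V.1}
    (h : σ.toFun V = t.subst σ) : (single V t).comp σ = σ := by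
  ext W
  change ((single V t).toFun W).subst σ = _
  by_cases hW : W = V
  · subst hW
    rw [single_self, h]
  · rw [single_of_ne _ hW, Exp.subst_ofVar]

theorem Exp.subst_single_of_notMem {V : Var} {E : Exp S [] V.1} {Γ : List ATy} {τ : ATy}
    {e : Exp S Γ τ} (h : V ∉ e.fv) : e.subst (Subst.single V E) = e := by
  conv_rhs => rw [← subst_id e]
  refine subst_congr fun W hW => ?_
  rw [Subst.single_of_ne]
  · rfl
  · rintro rfl
    exact h hW

theorem Exp.fv_subst_single_subset {V : Var} {E : Exp S [] V.1} {Γ : List ATy} {τ : ATy}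
    (e : Exp S Γ τ) : (e.subst (Subst.single V E)).fv ⊆ (e.fv \ {V}) ∪ E.fv := by
  intro W hW
  simp only [fv_subst, Set.mem_iUnion] at hW
  obtain ⟨X, hX, hW⟩ := hW
  by_cases h : X = V
  · subst h
    rw [Subst.single_self] at hW
    exact Or.inr hW
  · rw [Subst.single_of_ne _ h] at hW
    cases hW
    exact Or.inl ⟨hX, h⟩

/-- Elimination of a variable from a system of equations. -/
theorem IsStrongMGU.eliminate {μ : Subst S} {n : ℕ} {t : Exp S [] ATy.i}
    {l : List (Exp S [] ATy.i × Exp S [] ATy.i)} (hn : (ATy.i, n) ∉ t.fv)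
    (h : IsStrongMGU μ (l.map fun p => (p.1.subst (Subst.single (ATy.i, n) t),
      p.2.subst (Subst.single (ATy.i, n) t)))) :
    IsStrongMGU ((Subst.single (ATy.i, n) t).comp μ) ((Exp.fvar ATy.i n, t) :: l) where
  zeroOrder V hV := by
    rcases Subst.dom_comp_subset _ _ hV with h' | h'
    · rw [Subst.dom_single_subset _ _ h']
    · exact h.zeroOrder V h'
  solves := by
    rw [solves_cons]
    constructor
    · simp only [← Exp.subst_subst, Exp.subst_single_of_notMem hn]
      simp [Exp.subst]
    · intro p hp
      simpa [Exp.subst_subst] using h.solves _ (List.mem_map_of_mem hp)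
  vars_subset := by
    refine (Subst.vars_comp_subset _ _).trans (Set.union_subset ?_ (h.vars_subset.trans ?_))
    · refine (Subst.vars_single_subset _ _).trans fun V hV => ⟨_, List.mem_cons_self, ?_⟩
      exact hV
    · rintro V ⟨q, hq, hV⟩
      obtain ⟨p, hp, rfl⟩ := List.mem_map.1 hq
      rcases hV with hV | hV
      · rcases Exp.fv_subst_single_subset _ hV with hV | hV
        · exact ⟨p, List.mem_cons_of_mem _ hp, Or.inl hV.1⟩
        · exact ⟨_, List.mem_cons_self, Or.inr hV⟩
      · rcases Exp.fv_subst_single_subset _ hV with hV | hV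
        · exact ⟨p, List.mem_cons_of_mem _ hp, Or.inr hV.1⟩
        · exact ⟨_, List.mem_cons_self, Or.inr hV⟩
  comp_eq σ hσ := by
    rw [solves_cons] at hσ
    have h₁ : (Subst.single (ATy.i, n) t).comp σ = σ :=
      Subst.single_comp_of_eq (by simpa [Exp.subst] using hσ.1)
    rw [Subst.comp_assoc, h.comp_eq σ, h₁]
    intro q hq
    obtain ⟨p, hp, rfl⟩ := List.mem_map.1 hq
    simpa only [Exp.subst_subst, h₁] using hσ.2 p hp

theorem IsStrongMGU.congr {μ : Subst S} {l l' : List (Exp S [] ATy.i × Exp S [] ATy.i)}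
    (h : IsStrongMGU μ l) (hl : ∀ σ : Subst S, Solves σ l ↔ Solves σ l')
    (hv : eqsVars l ⊆ eqsVars l') : IsStrongMGU μ l' :=
  ⟨h.zeroOrder, (hl μ).1 h.solves, h.vars_subset.trans hv, fun σ hσ => h.comp_eq σ ((hl σ).2 hσ)⟩

/-- No variables are created, and the eliminated one is gone because it does not occur in `t`. -/
theorem ncard_eqsVars_eliminate_lt {n : ℕ} {t : Exp S [] ATy.i}
    {l : List (Exp S [] ATy.i × Exp S [] ATy.i)} (hn : (ATy.i, n) ∉ t.fv) :
    (eqsVars (l.map fun p => (p.1.subst (Subst.single (ATy.i, n) t),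
      p.2.subst (Subst.single (ATy.i, n) t)))).ncard <
      (eqsVars ((Exp.fvar ATy.i n, t) :: l)).ncard := by
  refine Set.ncard_lt_ncard ?_ (eqsVars_finite _)
  refine (Set.ssubset_iff_of_subset ?_).2
    ⟨(ATy.i, n), ⟨_, List.mem_cons_self, Or.inl rfl⟩, ?_⟩
  · rintro V ⟨q, hq, hV⟩
    obtain ⟨p, hp, rfl⟩ := List.mem_map.1 hq
    rcases hV with hV | hV
    · rcases Exp.fv_subst_single_subset _ hV with hV | hV
      · exact ⟨p, List.mem_cons_of_mem _ hp, Or.inl hV.1⟩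
      · exact ⟨_, List.mem_cons_self, Or.inr hV⟩
    · rcases Exp.fv_subst_single_subset _ hV with hV | hV
      · exact ⟨p, List.mem_cons_of_mem _ hp, Or.inr hV.1⟩
      · exact ⟨_, List.mem_cons_self, Or.inr hV⟩
  · rintro ⟨q, hq, hV⟩
    obtain ⟨p, hp, rfl⟩ := List.mem_map.1 hq
    rcases hV with hV | hV
    · rcases Exp.fv_subst_single_subset _ hV with hV | hV
      · exact hV.2 rfl
      · exact hn hV
    · rcases Exp.fv_subst_single_subset _ hV with hV | hV
      · exact hV.2 rfl
      · exact hn hV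

theorem eqsVars_cons_swap (s t : Exp S [] ATy.i) (l : List (Exp S [] ATy.i × Exp S [] ATy.i)) :
    eqsVars ((s, t) :: l) = eqsVars ((t, s) :: l) := by
  ext V
  simp [eqsVars, or_comm]

/-- A solvable system of equations has a most general solution. -/
theorem exists_isStrongMGU (l : List (Exp S [] ATy.i × Exp S [] ATy.i)) {σ : Subst S}
    (hσ : Solves σ l) : ∃ μ : Subst S, IsStrongMGU μ l := by
  -- Lexicographic induction on the number of variables and the total size. Elimination lowers the
  -- first; deletion and decomposition lower the second without raising the first.
  induction hN : (eqsVars l).ncard using Nat.strong_induction_on generalizing l with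
  | _ N ihN =>
  induction hM : eqsSize l using Nat.strong_induction_on generalizing l with
  | _ M ihM =>
  have elim : ∀ (n : ℕ) (t : Exp S [] ATy.i) (l' : List (Exp S [] ATy.i × Exp S [] ATy.i)),
      t ≠ Exp.fvar ATy.i n → Solves σ ((Exp.fvar ATy.i n, t) :: l') →
      (eqsVars ((Exp.fvar ATy.i n, t) :: l')).ncard = N →
      ∃ μ : Subst S, IsStrongMGU μ ((Exp.fvar ATy.i n, t) :: l') := by
    intro n t l' ht hs hv
    rw [solves_cons] at hs
    -- The occurs check cannot fail, as `σ` is a solution.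
    have hn : (ATy.i, n) ∉ t.fv := fun hn =>
      Exp.toFun_ne_subst_of_mem_fv σ n t ht hn (by simpa [Exp.subst] using hs.1)
    have h₁ : (Subst.single (ATy.i, n) t).comp σ = σ :=
      Subst.single_comp_of_eq (by simpa [Exp.subst] using hs.1)
    obtain ⟨μ, hμ⟩ := ihN _ (hv ▸ ncard_eqsVars_eliminate_lt hn) _ (by
      intro q hq
      obtain ⟨p, hp, rfl⟩ := List.mem_map.1 hq
      simpa only [Exp.subst_subst, h₁] using hs.2 p hp) rfl
    exact ⟨_, hμ.eliminate hn⟩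
  -- A smaller system with the same solutions and no new variables.
  have reduce : ∀ l' : List (Exp S [] ATy.i × Exp S [] ATy.i), eqsSize l' < M →
      (∀ τ : Subst S, Solves τ l' ↔ Solves τ l) → eqsVars l' ⊆ eqsVars l →
      ∃ μ : Subst S, IsStrongMGU μ l := by
    intro l' hlt hiff hsub
    have hle := Set.ncard_le_ncard hsub (eqsVars_finite l)
    have hs := (hiff σ).2 hσ
    obtain ⟨μ, hμ⟩ : ∃ μ : Subst S, IsStrongMGU μ l' := by
      rcases (hN ▸ hle).lt_or_eq with h | h
      · exact ihN _ h l' hs rfl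
      · exact ihM _ hlt l' hs h rfl
    exact ⟨μ, hμ.congr hiff hsub⟩
  rcases l with _ | ⟨⟨s, t⟩, l⟩
  · exact ⟨Subst.id, fun V hV => by simp [Subst.dom_id] at hV, fun p hp => by simp at hp,
      by simp [Subst.vars_id], fun τ _ => Subst.id_comp τ⟩
  by_cases hst : s = t
  · subst hst
    refine reduce l ?_ (fun τ => by simp [solves_cons]) ?_
    · have := s.size_pos
      simp only [eqsSize, List.map_cons, List.sum_cons] at hM ⊢
      omega
    · rintro V ⟨p, hp, hV⟩
      exact ⟨p, List.mem_cons_of_mem _ hp, hV⟩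
  cases s with
  | bvar x => cases x
  | fvar _ n => exact elim n t l (Ne.symm hst) hσ hN
  | fn f a =>
    cases t with
    | bvar x => cases x
    | fvar _ n =>
      rw [eqsVars_cons_swap] at hN
      obtain ⟨μ, hμ⟩ := elim n (Exp.fn f a) l hst
        (by rw [solves_cons] at hσ ⊢; exact ⟨hσ.1.symm, hσ.2⟩) hN
      refine ⟨μ, hμ.congr (fun τ => ?_) (eqsVars_cons_swap _ _ _).le⟩
      rw [solves_cons, solves_cons, eq_comm]
    | fn g b =>
      -- Nor can the function symbols clash. Decomposition into the argument equations then saves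
      -- the two occurrences of the head symbol.
      have h := (solves_cons.1 hσ).1
      simp only [Exp.subst, Exp.fn.injEq] at h
      obtain ⟨rfl, h, -⟩ := h
      cases h
      refine reduce ((List.ofFn fun k => (a k, b k)) ++ l) ?_ (fun τ => ?_) ?_
      · subst hM
        simp only [eqsSize, List.map_append, List.sum_append, List.map_ofFn, List.sum_ofFn,
          List.map_cons, List.sum_cons, Exp.size, Function.comp_apply, Finset.sum_add_distrib]
        omega
      · simp only [Solves, List.mem_append, List.mem_cons, List.mem_ofFn]
        constructor
        · rintro h p (rfl | hp)
          · simp only [Exp.subst]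
            congr 1
            funext k
            exact h (a k, b k) (Or.inl ⟨k, rfl⟩)
          · exact h p (Or.inr hp)
        · rintro h p (⟨k, rfl⟩ | hp)
          · have := h _ (Or.inl rfl)
            simp only [Exp.subst, Exp.fn.injEq, heq_eq_eq, true_and] at this
            exact congrFun this k
          · exact h p (Or.inr hp)
      · rintro V ⟨p, hp, hV⟩
        rcases List.mem_append.1 hp with hp | hp
        · obtain ⟨k, rfl⟩ := List.mem_ofFn.1 hp
          exact ⟨_, List.mem_cons_self, hV.imp (fun h => Set.mem_iUnion.2 ⟨k, h⟩)
            (fun h => Set.mem_iUnion.2 ⟨k, h⟩)⟩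
        · exact ⟨p, List.mem_cons_of_mem _ hp, hV⟩

/-- A zero-order unifier `σ` equals `μσ`, so it serves as its own zero-order factor. -/
theorem IsStrongMGU.isMGU {μ : Subst S} {s t : Exp S [] ATy.i} (h : IsStrongMGU μ [(s, t)]) :
    μ.IsMGU s t :=
  ⟨⟨h.zeroOrder, h.solves _ (List.mem_singleton_self _)⟩, fun σ hσ =>
    ⟨σ, hσ.1, (h.comp_eq σ (by simpa [Solves] using hσ.2)).symm⟩⟩

/-! ### Substitution in basic expressions -/

/-- Application of a substitution to the members of a list of expressions. -/
def ExpList.subst (θ : Subst S) (L : ExpList S) : ExpList S :=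
  L.map fun b => ⟨b.1, b.2.subst θ⟩

/-- Here and in the analogues below, the frame of the expression is made of bound variables and
logical symbols, so a substitution acts on the basic subexpressions only. -/
theorem IsCall.subst (θ : Subst S) {Γ : List ATy} {π₀ : PTy} {x : BVar Γ (ATy.pred π₀)} {π : PTy}
    {e : Exp S Γ (ATy.pred π)} {L : ExpList S} (h : IsCall x e L) :
    IsCall x (e.subst θ) (ExpList.subst θ L) := by
  induction h with
  | head => exact .head
  | app h B ih =>
    simp only [Exp.subst, Exp.subst_weaken, ExpList.subst, List.map_append] at ih ⊢
    exact ih.app _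

theorem IsCalls.subst (θ : Subst S) {Γ : List ATy} {π₀ : PTy} {x : BVar Γ (ATy.pred π₀)}
    {e : Exp S Γ ATy.o} {L : ExpList S} (h : IsCalls x e L) :
    IsCalls x (e.subst θ) (ExpList.subst θ L) := by
  induction h with
  | single h => exact .single (h.subst θ)
  | and h₁ h₂ ih₁ ih₂ =>
    simp only [Exp.subst, ExpList.subst, List.map_append] at ih₁ ih₂ ⊢
    exact ih₁.and ih₂

theorem IsConjunct.subst (θ : Subst S) {Γ : List ATy} {ρ : ATy} {x : BVar Γ ρ}
    {e : Exp S Γ ATy.o} {L : ExpList S} (h : IsConjunct x e L) :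
    IsConjunct x (e.subst θ) (ExpList.subst θ L) := by
  cases h with
  | eq B =>
    simp only [Exp.subst, Exp.subst_weaken]
    exact .eq _ _
  | one => exact .one _
  | prop => exact .prop _
  | calls _ hπ h => exact .calls _ hπ (h.subst θ)

theorem IsConj.subst (θ : Subst S) {Γ : List ATy} {xs : List (Σ ρ : ATy, BVar Γ ρ)}
    {e : Exp S Γ ATy.o} {L : ExpList S} (h : IsConj xs e L) :
    IsConj xs (e.subst θ) (ExpList.subst θ L) := by
  induction h with
  | single h => exact .single (h.subst θ)
  | and h₁ h₂ ih₁ ih₂ =>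
    simp only [Exp.subst, ExpList.subst, List.map_append] at ih₁ ih₂ ⊢
    exact ih₁.and ih₂

theorem IsStepExp.subst (θ : Subst S) {Γ : List ATy} {π : PTy} {e : Exp S Γ (ATy.pred π)}
    {L : ExpList S} (h : IsStepExp e L) : IsStepExp (e.subst θ) (ExpList.subst θ L) := by
  induction h with
  | bot hΓ => exact .bot hΓ
  | conj h => exact .conj (h.subst θ)
  | lam h ih => exact .lam ih

theorem IsUnionExp.subst (θ : Subst S) {π : PTy} {e : Exp S [] (ATy.pred π)} {L : ExpList S}
    (h : IsUnionExp e L) : IsUnionExp (e.subst θ) (ExpList.subst θ L) := by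
  induction h with
  | single h => exact .single (h.subst θ)
  | or h₁ h₂ ih₁ ih₂ =>
    simp only [Exp.subst, ExpList.subst, List.map_append] at ih₁ ih₂ ⊢
    exact ih₁.or ih₂

theorem isBasic_ofVar (V : Var) : IsBasic (Exp.ofVar V : Exp S [] V.1) := by
  obtain ⟨ρ | π, n⟩ := V
  · exact .term _
  · exact .var _ _

theorem Subst.IsBasic.toFun {θ : Subst S} (hθ : θ.IsBasic) (V : Var) :
    HOLP.IsBasic (θ.toFun V) := by
  by_cases h : V ∈ θ.dom
  · exact hθ V h
  · simp only [dom, Set.mem_ofPred_eq, not_not] at h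
    rw [h]
    exact isBasic_ofVar V

theorem IsBasic.subst {θ : Subst S} (hθ : θ.IsBasic) {ρ : ATy} {e : Exp S [] ρ}
    (h : IsBasic e) : IsBasic (e.subst θ) := by
  induction h with
  | term t => exact .term _
  | var π n => simpa [Exp.subst] using hθ.toFun _
  | zero => exact .zero
  | one => exact .one
  | union h hL ih =>
    refine .union (h.subst θ) fun b hb => ?_
    obtain ⟨c, hc, rfl⟩ := List.mem_map.1 hb
    exact ih c hc

theorem Subst.IsBasic.comp {θ σ : Subst S} (hθ : θ.IsBasic) (hσ : σ.IsBasic) :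
    (θ.comp σ).IsBasic :=
  fun V _ => IsBasic.subst hσ (hθ.toFun V)

theorem Subst.isBasic_id : (Subst.id : Subst S).IsBasic := by
  intro V hV
  simp [dom_id] at hV

theorem Subst.IsBasic.single {V : Var} {E : Exp S [] V.1} (hE : HOLP.IsBasic E) :
    (Subst.single V E).IsBasic := by
  intro W hW
  cases dom_single_subset V E hW
  rwa [single_self]

theorem Subst.IsZeroOrder.isBasic {θ : Subst S} (h : θ.IsZeroOrder) : θ.IsBasic := by
  rintro ⟨ρ, n⟩ hV
  obtain rfl : ρ = ATy.i := h _ hV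
  exact .term _

theorem Subst.IsBasic.override {θ : Subst S} (hθ : θ.IsBasic) {T : List Var}
    {ξ : ∀ V : Var, Exp S [] V.1} (hξ : ∀ V ∈ T, HOLP.IsBasic (ξ V)) : (θ.override T ξ).IsBasic := by
  intro V _
  by_cases h : V ∈ T
  · rw [override_of_mem θ ξ h]
    exact hξ V h
  · rw [override_of_notMem θ ξ h]
    exact hθ.toFun V

theorem IsTemplate.isBasic {π : PTy} {e : Exp S [] (ATy.pred π)} {T : List Var}
    (h : IsTemplate e T) : IsBasic e := by
  cases h with
  | zero => exact .zero
  | one => exact .one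
  | union hT h =>
    refine .union h fun b hb => ?_
    obtain ⟨V, -, rfl⟩ := List.mem_map.1 hb
    exact isBasic_ofVar V

/-! ### The shape of basic expressions -/

theorem IsConj.ne_nil {Γ : List ATy} {xs : List (Σ ρ : ATy, BVar Γ ρ)} {e : Exp S Γ ATy.o}
    {L : ExpList S} (h : IsConj xs e L) : xs ≠ [] := by
  induction h with
  | single h => simp
  | and h₁ h₂ ih₁ ih₂ => simp [ih₁]

/-- Both kinds of body require at least one enclosing binder, so in the empty context only the `λ`
case is left. -/
theorem IsStepExp.exists_lam {π : PTy} {e : Exp S [] (ATy.pred π)} {L : ExpList S}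
    (h : IsStepExp e L) : ∃ (ρ : ATy) (π' : PTy) (hπ : π = PTy.arr ρ π')
      (e' : Exp S [ρ] (ATy.pred π')), e = hπ ▸ Exp.lam e' := by
  cases h with
  | bot hΓ => exact absurd rfl hΓ
  | conj h => exact absurd rfl h.ne_nil
  | lam h => exact ⟨_, _, rfl, _, rfl⟩

theorem IsUnionExp.lam_or_or {π : PTy} {e : Exp S [] (ATy.pred π)} {L : ExpList S}
    (h : IsUnionExp e L) : π ≠ PTy.o ∧ ((∃ (ρ : ATy) (π' : PTy) (hπ : π = PTy.arr ρ π')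
      (e' : Exp S [ρ] (ATy.pred π')), e = hπ ▸ Exp.lam e') ∨ ∃ e₁ e₂, e = Exp.or e₁ e₂) := by
  induction h with
  | single h =>
    obtain ⟨ρ, π', rfl, e', rfl⟩ := h.exists_lam
    exact ⟨nofun, Or.inl ⟨ρ, π', rfl, e', rfl⟩⟩
  | or h₁ h₂ ih₁ ih₂ => exact ⟨ih₁.1, Or.inr ⟨_, _, rfl⟩⟩

/-- This and the next three lemmas show that a variable cannot have an instance of these forms under
a basic substitution. The connective of an instance `Aθ` is therefore already present in `A`. -/
theorem not_isBasic_app {ρ : ATy} {π : PTy} (e : Exp S [] (ATy.pred (PTy.arr ρ π)))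
    (a : Exp S [] ρ) : ¬ IsBasic (Exp.app e a) := by
  generalize he : Exp.app e a = e'
  intro h
  cases h with
  | union h hL =>
    subst he
    obtain ⟨-, ⟨ρ, π, rfl, e', h⟩ | ⟨e₁, e₂, h⟩⟩ := h.lam_or_or <;> cases h
  | _ => cases he

theorem not_isBasic_and {π : PTy} (e₁ e₂ : Exp S [] (ATy.pred π)) :
    ¬ IsBasic (Exp.and e₁ e₂) := by
  generalize he : Exp.and e₁ e₂ = e'
  intro h
  cases h with
  | union h hL =>
    subst he
    obtain ⟨-, ⟨ρ, π, rfl, e', h⟩ | ⟨e₁, e₂, h⟩⟩ := h.lam_or_or <;> cases h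
  | _ => cases he

theorem not_isBasic_eq (e₁ e₂ : Exp S [] ATy.i) : ¬ IsBasic (Exp.eq e₁ e₂) := by
  generalize he : Exp.eq e₁ e₂ = e'
  intro h
  cases h with
  | union h hL => exact h.lam_or_or.1 rfl
  | _ => cases he

theorem not_isBasic_ex {ρ : ATy} (e : Exp S [ρ] ATy.o) : ¬ IsBasic (Exp.ex e) := by
  generalize he : Exp.ex e = e'
  intro h
  cases h with
  | union h hL => exact h.lam_or_or.1 rfl
  | _ => cases he

/-- Hence a single template step suffices to expose the head of a formula. -/
theorem IsTemplate.ne_fvar {π : PTy} {e : Exp S [] (ATy.pred π)} {T : List Var}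
    (h : IsTemplate e T) (n : ℕ) : e ≠ Exp.fvar (ATy.pred π) n := by
  rintro he
  cases h with
  | zero => cases he
  | one => cases he
  | union hT h =>
    subst he
    obtain ⟨-, ⟨ρ, π, rfl, e', h⟩ | ⟨e₁, e₂, h⟩⟩ := h.lam_or_or <;> cases h

/-! ### Templates of basic expressions -/

/-- The members of a list of variables, as expressions. -/
def varList (T : List Var) : ExpList S := T.map fun V => ⟨V.1, Exp.ofVar V⟩

/-- The values of `ξ` at the members of a list of variables. -/
def valueList (ξ : ∀ V : Var, Exp S [] V.1) (T : List Var) : ExpList S :=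
  T.map fun V => ⟨V.1, ξ V⟩

/-- The expression `e'` has variables in `T` only, and becomes `e` when these are replaced by their
values under `ξ`. -/
def IsPattern (ξ : ∀ V : Var, Exp S [] V.1) (T : List Var) {Γ : List ATy} {τ : ATy}
    (e' e : Exp S Γ τ) : Prop :=
  (∀ V ∈ e'.fv, V ∈ T) ∧
    ∀ θ : Subst S, (∀ V ∈ T, θ.toFun V = ξ V) → e'.subst θ = e

theorem IsPattern.binary {ξ : ∀ V : Var, Exp S [] V.1} {T₁ T₂ : List Var} {Γ : List ATy}
    {τ₁ τ₂ τ : ATy} {e₁' e₁ : Exp S Γ τ₁} {e₂' e₂ : Exp S Γ τ₂}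
    (f : Exp S Γ τ₁ → Exp S Γ τ₂ → Exp S Γ τ)
    (hfv : ∀ a b, (f a b).fv = a.fv ∪ b.fv)
    (hsubst : ∀ (θ : Subst S) a b, (f a b).subst θ = f (a.subst θ) (b.subst θ))
    (h₁ : IsPattern ξ T₁ e₁' e₁) (h₂ : IsPattern ξ T₂ e₂' e₂) :
    IsPattern ξ (T₁ ++ T₂) (f e₁' e₂') (f e₁ e₂) := by
  constructor
  · intro V hV
    rw [hfv] at hV
    exact List.mem_append.2 (hV.imp (h₁.1 V) (h₂.1 V))
  · intro θ hθ
    rw [hsubst, h₁.2 θ fun V hV => hθ V (List.mem_append_left _ hV),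
      h₂.2 θ fun V hV => hθ V (List.mem_append_right _ hV)]

theorem isPattern_ofVar (ξ : ∀ V : Var, Exp S [] V.1) (Γ : List ATy) (V : Var) :
    IsPattern ξ [V] (Exp.ofVar V : Exp S [] V.1).weaken (Γ := Γ) (ξ V).weaken := by
  constructor
  · intro W hW
    simpa using hW
  · intro θ hθ
    rw [Exp.subst_weaken, Exp.subst_ofVar, hθ V (List.mem_singleton_self V)]

theorem isPattern_closed (ξ : ∀ V : Var, Exp S [] V.1) {Γ : List ATy} {τ : ATy} {e : Exp S Γ τ}
    (he : e.fv = ∅) : IsPattern ξ [] e e :=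
  ⟨by simp [he], fun _ _ => Exp.subst_of_fv_eq_empty he⟩

/-- Each basic subexpression is replaced by the variable of `T` that stands for it. Since `T` is
prescribed for the whole list `L`, it is simply cut wherever `L` is a concatenation, and
distinctness and freshness have to be arranged only once. -/
theorem IsCall.exists_pattern (ξ : ∀ V : Var, Exp S [] V.1) {Γ : List ATy} {π₀ : PTy}
    {x : BVar Γ (ATy.pred π₀)} {π : PTy} {e : Exp S Γ (ATy.pred π)} {L : ExpList S}
    (h : IsCall x e L) : ∀ T : List Var, valueList ξ T = L →
    ∃ e', IsCall x e' (varList T) ∧ IsPattern ξ T e' e := by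
  induction h with
  | head =>
    intro T hT
    obtain rfl := List.map_eq_nil_iff.1 hT
    exact ⟨_, .head, isPattern_closed ξ rfl⟩
  | app h B ih =>
    intro T hT
    obtain ⟨T₁, T₂, rfl, h₁, h₂⟩ := List.map_eq_append_iff.1 hT
    obtain ⟨V, rfl, hV⟩ := List.map_eq_singleton_iff.1 h₂
    cases hV
    obtain ⟨e', he', hp⟩ := ih T₁ h₁
    refine ⟨.app e' (Exp.ofVar V : Exp S [] V.1).weaken, ?_,
      IsPattern.binary Exp.app (fun _ _ => rfl) (fun _ _ _ => rfl) hp (isPattern_ofVar ξ _ V)⟩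
    simp only [varList, List.map_append]
    exact he'.app _

theorem IsCalls.exists_pattern (ξ : ∀ V : Var, Exp S [] V.1) {Γ : List ATy} {π₀ : PTy}
    {x : BVar Γ (ATy.pred π₀)} {e : Exp S Γ ATy.o} {L : ExpList S}
    (h : IsCalls x e L) : ∀ T : List Var, valueList ξ T = L →
    ∃ e', IsCalls x e' (varList T) ∧ IsPattern ξ T e' e := by
  induction h with
  | single h =>
    intro T hT
    obtain ⟨e', he', hp⟩ := h.exists_pattern ξ T hT
    exact ⟨e', .single he', hp⟩
  | and h₁ h₂ ih₁ ih₂ =>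
    intro T hT
    obtain ⟨T₁, T₂, rfl, hT₁, hT₂⟩ := List.map_eq_append_iff.1 hT
    obtain ⟨e₁', he₁', hp₁⟩ := ih₁ T₁ hT₁
    obtain ⟨e₂', he₂', hp₂⟩ := ih₂ T₂ hT₂
    refine ⟨.and e₁' e₂', ?_,
      IsPattern.binary Exp.and (fun _ _ => rfl) (fun _ _ _ => rfl) hp₁ hp₂⟩
    simp only [varList, List.map_append]
    exact he₁'.and he₂'

theorem IsConjunct.exists_pattern (ξ : ∀ V : Var, Exp S [] V.1) {Γ : List ATy} {ρ : ATy}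
    {x : BVar Γ ρ} {e : Exp S Γ ATy.o} {L : ExpList S} (h : IsConjunct x e L) (T : List Var)
    (hT : valueList ξ T = L) : ∃ e', IsConjunct x e' (varList T) ∧ IsPattern ξ T e' e := by
  cases h with
  | eq B =>
    obtain ⟨⟨ρ, n⟩, rfl, hV⟩ := List.map_eq_singleton_iff.1 hT
    cases hV
    exact ⟨_, .eq _ _, IsPattern.binary (T₁ := []) Exp.eq (fun _ _ => rfl) (fun _ _ _ => rfl)
      (isPattern_closed ξ rfl) (isPattern_ofVar ξ _ (ATy.i, n))⟩
  | one =>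
    obtain rfl := List.map_eq_nil_iff.1 hT
    exact ⟨_, .one _, isPattern_closed ξ rfl⟩
  | prop =>
    obtain rfl := List.map_eq_nil_iff.1 hT
    exact ⟨_, .prop _, isPattern_closed ξ rfl⟩
  | calls _ hπ h =>
    obtain ⟨e', he', hp⟩ := h.exists_pattern ξ T hT
    exact ⟨e', .calls _ hπ he', hp⟩

theorem IsConj.exists_pattern (ξ : ∀ V : Var, Exp S [] V.1) {Γ : List ATy}
    {xs : List (Σ ρ : ATy, BVar Γ ρ)} {e : Exp S Γ ATy.o} {L : ExpList S} (h : IsConj xs e L) :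
    ∀ T : List Var, valueList ξ T = L →
    ∃ e', IsConj xs e' (varList T) ∧ IsPattern ξ T e' e := by
  induction h with
  | single h =>
    intro T hT
    obtain ⟨e', he', hp⟩ := h.exists_pattern ξ T hT
    exact ⟨e', .single he', hp⟩
  | and h₁ h₂ ih₁ ih₂ =>
    intro T hT
    obtain ⟨T₁, T₂, rfl, hT₁, hT₂⟩ := List.map_eq_append_iff.1 hT
    obtain ⟨e₁', he₁', hp₁⟩ := ih₁ T₁ hT₁
    obtain ⟨e₂', he₂', hp₂⟩ := ih₂ T₂ hT₂
    refine ⟨.and e₁' e₂', ?_,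
      IsPattern.binary Exp.and (fun _ _ => rfl) (fun _ _ _ => rfl) hp₁ hp₂⟩
    simp only [varList, List.map_append]
    exact he₁'.and he₂'

theorem IsStepExp.exists_pattern (ξ : ∀ V : Var, Exp S [] V.1) {Γ : List ATy} {π : PTy}
    {e : Exp S Γ (ATy.pred π)} {L : ExpList S} (h : IsStepExp e L) (T : List Var)
    (hT : valueList ξ T = L) : ∃ e', IsStepExp e' (varList T) ∧ IsPattern ξ T e' e := by
  induction h with
  | bot hΓ =>
    obtain rfl := List.map_eq_nil_iff.1 hT
    exact ⟨_, .bot hΓ, isPattern_closed ξ rfl⟩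
  | conj h =>
    obtain ⟨e', he', hp⟩ := h.exists_pattern ξ T hT
    exact ⟨e', .conj he', hp⟩
  | lam h ih =>
    obtain ⟨e', he', hp⟩ := ih hT
    exact ⟨.lam e', .lam he', hp.1, fun θ hθ => congrArg Exp.lam (hp.2 θ hθ)⟩

theorem IsUnionExp.exists_pattern (ξ : ∀ V : Var, Exp S [] V.1) {π : PTy}
    {e : Exp S [] (ATy.pred π)} {L : ExpList S} (h : IsUnionExp e L) :
    ∀ T : List Var, valueList ξ T = L →
    ∃ e', IsUnionExp e' (varList T) ∧ IsPattern ξ T e' e := by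
  induction h with
  | single h =>
    intro T hT
    obtain ⟨e', he', hp⟩ := h.exists_pattern ξ T hT
    exact ⟨e', .single he', hp⟩
  | or h₁ h₂ ih₁ ih₂ =>
    intro T hT
    obtain ⟨T₁, T₂, rfl, hT₁, hT₂⟩ := List.map_eq_append_iff.1 hT
    obtain ⟨e₁', he₁', hp₁⟩ := ih₁ T₁ hT₁
    obtain ⟨e₂', he₂', hp₂⟩ := ih₂ T₂ hT₂
    refine ⟨.or e₁' e₂', ?_,
      IsPattern.binary Exp.or (fun _ _ => rfl) (fun _ _ _ => rfl) hp₁ hp₂⟩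
    simp only [varList, List.map_append]
    exact he₁'.or he₂'

theorem exists_fresh_var (ρ : ATy) {F : Set Var} (hF : F.Finite) : ∃ n : ℕ, (ρ, n) ∉ F := by
  by_contra! h
  exact Set.infinite_univ ((hF.preimage (Prod.mk_right_injective ρ).injOn).subset
    fun n _ => h n)

/-- Fresh variables that stand for the members of a list of expressions. -/
theorem exists_fresh_valueList (L : ExpList S) {F : Set Var} (hF : F.Finite) :
    ∃ (T : List Var) (ξ : ∀ V : Var, Exp S [] V.1), T.Nodup ∧ (∀ V ∈ T, V ∉ F) ∧
      valueList ξ T = L := by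
  classical
  induction L generalizing F with
  | nil => exact ⟨[], fun V => Exp.ofVar V, by simp, by simp, rfl⟩
  | cons b L ih =>
    obtain ⟨n, hn⟩ := exists_fresh_var b.1 hF
    -- Forbidding the new variable to the tail makes the variables distinct and keeps the update of
    -- `ξ` below harmless.
    obtain ⟨T, ξ, hT, hTF, hL⟩ := ih (hF.insert (b.1, n))
    have hnT : (b.1, n) ∉ T := fun h => hTF _ h (Set.mem_insert _ _)
    refine ⟨(b.1, n) :: T, Function.update ξ (b.1, n) b.2, List.nodup_cons.2 ⟨hnT, hT⟩, ?_, ?_⟩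
    · intro V hV
      rcases List.mem_cons.1 hV with rfl | hV
      · exact hn
      · exact fun h => hTF V hV (Set.mem_insert_of_mem _ h)
    · rw [← hL]
      simp only [valueList, List.map_cons, Function.update_self, List.cons.injEq, true_and]
      refine List.map_congr_left fun V hV => ?_
      rw [Function.update_of_ne]
      rintro rfl
      exact hnT hV

/-- Every basic expression of predicate type other than a variable is an instance of a basic
template with fresh template variables. -/
theorem IsBasic.exists_template {π : PTy} {e : Exp S [] (ATy.pred π)} (he : IsBasic e)
    (hne : ∀ n, e ≠ Exp.fvar (ATy.pred π) n) {F : Set Var} (hF : F.Finite) :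
    ∃ (B : Exp S [] (ATy.pred π)) (T : List Var) (ξ : ∀ V : Var, Exp S [] V.1),
      IsTemplate B T ∧ (∀ V ∈ T, V ∉ F) ∧ (∀ V ∈ T, IsBasic (ξ V)) ∧ IsPattern ξ T B e := by
  cases he with
  | var _ n => exact absurd rfl (hne n)
  | zero =>
    exact ⟨_, [], fun V => Exp.ofVar V, .zero, by simp, by simp, isPattern_closed _ rfl⟩
  | one =>
    exact ⟨_, [], fun V => Exp.ofVar V, .one, by simp, by simp, isPattern_closed _ rfl⟩
  | @union _ _ L h hL =>
    obtain ⟨T, ξ, hT, hTF, hTL⟩ := exists_fresh_valueList L hF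
    obtain ⟨B, hB, hp⟩ := h.exists_pattern ξ T hTL
    refine ⟨B, T, ξ, .union hT hB, hTF, fun V hV => ?_, hp⟩
    exact hL ⟨V.1, ξ V⟩ (hTL ▸ List.mem_map.2 ⟨V, hV, rfl⟩)

/-! ### Formulas with argument lists -/

/-- Application of a substitution to an argument list. -/
def Args.subst (θ : Subst S) : ∀ {π : PTy}, Args S π → Args S π
  | _, .nil => .nil
  | _, .cons a as => .cons (a.subst θ) (as.subst θ)

/-- The free variables of an argument list. -/
def Args.fv : ∀ {π : PTy}, Args S π → Set Var
  | _, .nil => ∅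
  | _, .cons a as => a.fv ∪ as.fv

theorem Args.subst_subst (θ σ : Subst S) {π : PTy} (as : Args S π) :
    (as.subst θ).subst σ = as.subst (θ.comp σ) := by
  induction as with
  | nil => rfl
  | cons a as ih => simp [subst, ih, Exp.subst_subst]

theorem Args.subst_congr {θ σ : Subst S} {π : PTy} {as : Args S π}
    (h : ∀ V ∈ as.fv, θ.toFun V = σ.toFun V) : as.subst θ = as.subst σ := by
  induction as with
  | nil => rfl
  | cons a as ih =>
    simp only [subst]
    rw [Exp.subst_congr fun V hV => h V (Or.inl hV), ih fun V hV => h V (Or.inr hV)]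

theorem Exp.subst_apps (θ : Subst S) {π : PTy} (e : Exp S [] (ATy.pred π)) (as : Args S π) :
    (e.apps as).subst θ = (e.subst θ).apps (as.subst θ) := by
  induction as with
  | nil => rfl
  | cons a as ih => exact ih _

theorem Exp.fv_apps {π : PTy} (e : Exp S [] (ATy.pred π)) (as : Args S π) :
    (e.apps as).fv = e.fv ∪ as.fv := by
  induction as with
  | nil => simp [apps, Args.fv]
  | cons a as ih => simp [apps, Args.fv, ih, fv, Set.union_assoc]

/-! ### Expressions with an instance of a given form -/

namespace Exp

/-- In this and the following inversions, a substitution changes the outermost symbol of an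
expression only if the expression is a variable. -/
theorem subst_eq_fvar {θ : Subst S} {ρ : ATy} {E : Exp S [] ρ} {n : ℕ}
    (h : E.subst θ = fvar ρ n) : ∃ m, E = fvar ρ m ∧ θ.toFun (ρ, m) = fvar ρ n := by
  cases E with
  | fvar _ m => exact ⟨m, rfl, by simpa [subst] using h⟩
  | bvar x => cases x
  | _ => cases h

theorem subst_eq_pcon {θ : Subst S} {π : PTy} {E : Exp S [] (ATy.pred π)} {p : S.Pred π}
    (h : E.subst θ = pcon p) : (∃ n, E = fvar _ n) ∨ E = pcon p := by
  cases E with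
  | fvar _ m => exact Or.inl ⟨m, rfl⟩
  | bvar x => cases x
  | pcon q => exact Or.inr h
  | _ => cases h

theorem subst_eq_one {θ : Subst S} {E : Goal S} (h : E.subst θ = one) :
    (∃ n, E = fvar _ n ∧ θ.toFun (ATy.o, n) = one) ∨ E = one := by
  cases E with
  | fvar _ m => exact Or.inl ⟨m, rfl, by simpa [subst] using h⟩
  | bvar x => cases x
  | one => exact Or.inr rfl
  | _ => cases h

theorem subst_eq_app {θ : Subst S} {ρ : ATy} {π : PTy} {E : Exp S [] (ATy.pred π)}
    {e : Exp S [] (ATy.pred (PTy.arr ρ π))} {a : Exp S [] ρ} (h : E.subst θ = app e a) :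
    (∃ n, E = fvar _ n ∧ θ.toFun (ATy.pred π, n) = app e a) ∨
      ∃ e' a', E = app e' a' ∧ e'.subst θ = e ∧ a'.subst θ = a := by
  cases E with
  | fvar _ m => exact Or.inl ⟨m, rfl, by simpa [subst] using h⟩
  | bvar x => cases x
  | app e' a' =>
    cases h
    exact Or.inr ⟨_, _, rfl, rfl, rfl⟩
  | _ => cases h

theorem subst_eq_lam {θ : Subst S} {ρ : ATy} {π : PTy} {E : Exp S [] (ATy.pred (PTy.arr ρ π))}
    {e : Exp S [ρ] (ATy.pred π)} (h : E.subst θ = lam e) :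
    (∃ n, E = fvar _ n) ∨ ∃ e', E = lam e' ∧ e'.subst θ = e := by
  cases E with
  | fvar _ m => exact Or.inl ⟨m, rfl⟩
  | bvar x => cases x
  | lam e' =>
    cases h
    exact Or.inr ⟨_, rfl, rfl⟩
  | _ => cases h

theorem subst_eq_and {θ : Subst S} {π : PTy} {E e₁ e₂ : Exp S [] (ATy.pred π)}
    (h : E.subst θ = and e₁ e₂) :
    (∃ n, E = fvar _ n ∧ θ.toFun (ATy.pred π, n) = and e₁ e₂) ∨
      ∃ e₁' e₂', E = and e₁' e₂' ∧ e₁'.subst θ = e₁ ∧ e₂'.subst θ = e₂ := by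
  cases E with
  | fvar _ m => exact Or.inl ⟨m, rfl, by simpa [subst] using h⟩
  | bvar x => cases x
  | and e' a' =>
    cases h
    exact Or.inr ⟨_, _, rfl, rfl, rfl⟩
  | _ => cases h

theorem subst_eq_or {θ : Subst S} {π : PTy} {E e₁ e₂ : Exp S [] (ATy.pred π)}
    (h : E.subst θ = or e₁ e₂) :
    (∃ n, E = fvar _ n) ∨
      ∃ e₁' e₂', E = or e₁' e₂' ∧ e₁'.subst θ = e₁ ∧ e₂'.subst θ = e₂ := by
  cases E with
  | fvar _ m => exact Or.inl ⟨m, rfl⟩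
  | bvar x => cases x
  | or e' a' =>
    cases h
    exact Or.inr ⟨_, _, rfl, rfl, rfl⟩
  | _ => cases h

theorem subst_eq_eq {θ : Subst S} {E : Goal S} {s t : Exp S [] ATy.i}
    (h : E.subst θ = eq s t) :
    (∃ n, E = fvar _ n ∧ θ.toFun (ATy.o, n) = eq s t) ∨
      ∃ s' t', E = eq s' t' ∧ s'.subst θ = s ∧ t'.subst θ = t := by
  cases E with
  | fvar _ m => exact Or.inl ⟨m, rfl, by simpa [subst] using h⟩
  | bvar x => cases x
  | eq e' a' =>
    cases h
    exact Or.inr ⟨_, _, rfl, rfl, rfl⟩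
  | _ => cases h

theorem subst_eq_ex {θ : Subst S} {E : Goal S} {ρ : ATy} {e : Exp S [ρ] ATy.o}
    (h : E.subst θ = ex e) :
    (∃ n, E = fvar _ n ∧ θ.toFun (ATy.o, n) = ex e) ∨ ∃ e', E = ex e' ∧ e'.subst θ = e := by
  cases E with
  | fvar _ m => exact Or.inl ⟨m, rfl, by simpa [subst] using h⟩
  | bvar x => cases x
  | ex e' =>
    cases h
    exact Or.inr ⟨_, rfl, rfl⟩
  | _ => cases h

/-- Since basic expressions are not applications, the arguments in a basic instance of a formula
come from arguments in the formula. -/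
theorem exists_apps_of_subst_eq {θ : Subst S} (hθ : θ.IsBasic) {π : PTy} (as : Args S π) :
    ∀ {A : Goal S} {E : Exp S [] (ATy.pred π)}, A.subst θ = E.apps as →
    ∃ (E' : Exp S [] (ATy.pred π)) (as' : Args S π),
      A = E'.apps as' ∧ E'.subst θ = E ∧ as'.subst θ = as := by
  induction as with
  | nil =>
    intro A E h
    exact ⟨A, .nil, rfl, h, rfl⟩
  | cons a as ih =>
    intro A E h
    obtain ⟨E', as', rfl, hE, has⟩ := ih h
    rcases subst_eq_app hE with ⟨n, rfl, hn⟩ | ⟨e', a', rfl, rfl, rfl⟩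
    · exact absurd (hn ▸ hθ.toFun _) (not_isBasic_app E a)
    · exact ⟨e', .cons a' as', rfl, rfl, by rw [← has]; rfl⟩

end Exp

/-! ### Lifting a derivation step -/

theorem Exp.subst_fvar_single {ρ : ATy} (n : ℕ) (B : Exp S [] ρ) :
    (fvar ρ n : Exp S [] ρ).subst (Subst.single (ρ, n) B) = B := by
  simp [subst]

/-- Binding `V` to a template of its value and then giving the template variables their values
restores `θ`. At `V` this is the pattern property; any other variable outside `T` is untouched. -/
theorem Subst.single_comp_override {θ : Subst S} {V : Var} {B : Exp S [] V.1} {T : List Var}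
    {ξ : ∀ V : Var, Exp S [] V.1} (h : IsPattern ξ T B (θ.toFun V)) {W : Var} (hW : W ∉ T) :
    ((single V B).comp (θ.override T ξ)).toFun W = θ.toFun W := by
  change ((single V B).toFun W).subst _ = _
  by_cases hWV : W = V
  · subst hWV
    rw [single_self]
    exact h.2 _ fun X hX => override_of_mem θ ξ hX
  · rw [single_of_ne _ hWV, Exp.subst_ofVar, override_of_notMem θ ξ hW]

/-- A step from `A` to an expression with instance `A₁`, without a substitution. -/
def SimpleLift (P : Program S) (A : Goal S) (θ : Subst S) (A₁ : Goal S) : Prop :=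
  ∃ A', Step P A Subst.id [] [] A' ∧ A'.subst θ = A₁ ∧ A'.fv ⊆ A.fv

/-- A step from `A` to an expression with instance `A₁`, after a predicate variable has been
replaced by a template of its value. -/
def TemplateLift (P : Program S) (F : Set Var) (A : Goal S) (θ : Subst S) (A₁ : Goal S) : Prop :=
  ∃ (π : PTy) (Q : ℕ) (B : Exp S [] (ATy.pred π)) (T : List Var) (ξ : ∀ V : Var, Exp S [] V.1),
    Step P A (Subst.single (ATy.pred π, Q) B) T []
      (A.subst (Subst.single (ATy.pred π, Q) B)) ∧
    IsTemplate B T ∧ (∀ V ∈ T, V ∉ F) ∧ (∀ V ∈ T, IsBasic (ξ V)) ∧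
    IsPattern ξ T B (θ.toFun (ATy.pred π, Q)) ∧ (ATy.pred π, Q) ∈ A.fv ∧
    SimpleLift P (A.subst (Subst.single (ATy.pred π, Q) B)) (θ.override T ξ) A₁

/-- A step from `A`, using `δ`, to an expression with the instance `A₁` under `θ'`, where `δθ'` agrees
with `θθ₁` except at the new variables. The template variables are not in `F`, nor are the released
variables, unless `K` holds, in which case the latter are those in `R`. -/
def StepLift (P : Program S) (K : Prop) (F : Set Var) (A : Goal S) (θ θ₁ : Subst S) (R : List Var)
    (A₁ : Goal S) : Prop :=
  ∃ (δ : Subst S) (T' R' : List Var) (A' : Goal S) (θ' : Subst S),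
    Step P A δ T' R' A' ∧ δ.IsBasic ∧ θ'.IsBasic ∧ A'.subst θ' = A₁ ∧
    (∀ V ∈ T', V ∉ F) ∧ (K → R' = R) ∧ (¬ K → ∀ V ∈ R', V ∉ F) ∧
    (∀ V, V ∉ T' → K ∨ V ∉ R' → (δ.comp θ').toFun V = (θ.comp θ₁).toFun V) ∧
    δ.vars ⊆ A.fv ∪ {V | V ∈ T'} ∧
    (K → A'.fv ⊆ A.fv ∪ {V | V ∈ T'} ∪ A₁.fv) ∧
    (K → θ'.dom ⊆ θ.dom ∪ θ₁.dom ∪ {V | V ∈ T'})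

theorem SimpleLift.stepLift {P : Program S} {A : Goal S} {θ : Subst S} {A₁ : Goal S}
    (h : SimpleLift P A θ A₁) (hθ : θ.IsBasic) (K : Prop) (F : Set Var) :
    StepLift P K F A θ Subst.id [] A₁ := by
  obtain ⟨A', h, h₁, hfv⟩ := h
  refine ⟨Subst.id, [], [], A', θ, h, Subst.isBasic_id, hθ, h₁, by simp, by simp, by simp, by simp,
    by simp [Subst.vars_id], fun _ => ?_, fun _ => ?_⟩
  · intro V hV
    exact Or.inl (Or.inl (hfv hV))
  · intro V hV
    exact Or.inl (Or.inl hV)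

/-- Lifting of a step that rewrites the head `E` of a formula `E E₁ ⋯ Eₙ`. -/
theorem lift_head {P : Program S} {F : Set Var} (hF : F.Finite) {θ : Subst S} (hθ : θ.IsBasic)
    {A A₁ : Goal S} (hA : A.fv ⊆ F) {π : PTy} {E : Exp S [] (ATy.pred π)} {as : Args S π}
    (h : A.subst θ = E.apps as) (hE : ∀ n, E ≠ Exp.fvar (ATy.pred π) n)
    (lift : ∀ (θ' : Subst S) E' as', (∀ n, E' ≠ Exp.fvar (ATy.pred π) n) → E'.subst θ' = E →
      as'.subst θ' = as → SimpleLift P (E'.apps as') θ' A₁) :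
    SimpleLift P A θ A₁ ∨ TemplateLift P F A θ A₁ := by
  obtain ⟨E', as', rfl, hE', has⟩ := Exp.exists_apps_of_subst_eq hθ as h
  by_cases hv : ∃ n, E' = Exp.fvar (ATy.pred π) n
  · obtain ⟨Q, rfl⟩ := hv
    replace hE' : θ.toFun (ATy.pred π, Q) = E := by simpa [Exp.subst] using hE'
    obtain ⟨B, T, ξ, hB, hTF, hξ, hp⟩ := IsBasic.exists_template (hE' ▸ hθ.toFun _) hE hF
    refine Or.inr ⟨π, Q, B, T, ξ, .template Q as' B T hB, hB, hTF, hξ, hE' ▸ hp, ?_, ?_⟩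
    · rw [Exp.fv_apps]
      exact Or.inl rfl
    · rw [Exp.subst_apps, Exp.subst_fvar_single]
      -- The head is now the template, which is not a variable. The instances of the arguments are
      -- unchanged, because the template variables avoid `F` and so do not occur in `A`.
      refine lift _ _ _ hB.ne_fvar (hp.2 _ fun V hV => Subst.override_of_mem _ _ hV) ?_
      rw [Args.subst_subst, ← has]
      refine Args.subst_congr fun V hV => ?_
      refine Subst.single_comp_override (hE' ▸ hp) fun hT => hTF V hT (hA ?_)
      rw [Exp.fv_apps]
      exact Or.inr hV
  · exact Or.inl (lift θ E' as' (not_exists.1 hv) hE' has)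

/-- The idle conjunct contains no new template variable, as its variables lie in `F`, so `δθ'` and
`θθ₁` agree on it. A variable released under `K` may lie in `F`, but there the agreement includes
released variables. -/
theorem StepLift.and_left {P : Program S} {K : Prop} {F : Set Var} {A B : Goal S}
    {θ θ₁ : Subst S} {R : List Var} {A₁ : Goal S} (h : StepLift P K F A θ θ₁ R A₁)
    (hB : B.fv ⊆ F) :
    StepLift P K F (.and A B) θ θ₁ R (.and A₁ ((B.subst θ).subst θ₁)) := by
  obtain ⟨δ, T', R', A', θ', hs, hδ, hθ', rfl, hT, hR, hR', heq, hvars, hfv, hdom⟩ := h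
  refine ⟨δ, T', R', _, θ', .andLeft B hs, hδ, hθ', ?_, hT, hR, hR', heq, ?_, fun hK => ?_, hdom⟩
  · simp only [Exp.subst, Exp.subst_subst]
    congr 1
    refine Exp.subst_congr fun V hV => heq V (fun h => hT V h (hB hV)) ?_
    by_cases hK : K
    · exact Or.inl hK
    · exact Or.inr fun h => hR' hK V h (hB hV)
  · exact hvars.trans (Set.union_subset_union_left _ Set.subset_union_left)
  · have h₁ := hfv hK
    have h₂ : (B.subst δ).fv ⊆ B.fv ∪ δ.vars := by
      rw [Exp.fv_subst]
      refine Set.iUnion₂_subset fun V hV => (δ.fv_toFun_subset V).trans ?_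
      exact Set.union_subset_union_left _ (Set.singleton_subset_iff.2 hV)
    simp only [Exp.fv]
    rintro V (hV | hV)
    · rcases h₁ hV with (h | h) | h
      · exact Or.inl (Or.inl (Or.inl h))
      · exact Or.inl (Or.inr h)
      · exact Or.inr (Or.inl h)
    · rcases h₂ hV with h | h
      · exact Or.inl (Or.inl (Or.inr h))
      · rcases hvars h with h | h
        · exact Or.inl (Or.inl (Or.inl h))
        · exact Or.inl (Or.inr h)

theorem StepLift.and_right {P : Program S} {K : Prop} {F : Set Var} {A B : Goal S}
    {θ θ₁ : Subst S} {R : List Var} {A₁ : Goal S} (h : StepLift P K F A θ θ₁ R A₁)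
    (hB : B.fv ⊆ F) :
    StepLift P K F (.and B A) θ θ₁ R (.and ((B.subst θ).subst θ₁) A₁) := by
  obtain ⟨δ, T', R', A', θ', hs, hδ, hθ', rfl, hT, hR, hR', heq, hvars, hfv, hdom⟩ := h
  refine ⟨δ, T', R', _, θ', .andRight B hs, hδ, hθ', ?_, hT, hR, hR', heq, ?_, fun hK => ?_, hdom⟩
  · simp only [Exp.subst, Exp.subst_subst]
    congr 1
    refine Exp.subst_congr fun V hV => heq V (fun h => hT V h (hB hV)) ?_
    by_cases hK : K
    · exact Or.inl hK
    · exact Or.inr fun h => hR' hK V h (hB hV)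
  · exact hvars.trans (Set.union_subset_union_left _ Set.subset_union_right)
  · have h₁ := hfv hK
    have h₂ : (B.subst δ).fv ⊆ B.fv ∪ δ.vars := by
      rw [Exp.fv_subst]
      refine Set.iUnion₂_subset fun V hV => (δ.fv_toFun_subset V).trans ?_
      exact Set.union_subset_union_left _ (Set.singleton_subset_iff.2 hV)
    simp only [Exp.fv]
    rintro V (hV | hV)
    · rcases h₂ hV with h | h
      · exact Or.inl (Or.inl (Or.inl h))
      · rcases hvars h with h | h
        · exact Or.inl (Or.inl (Or.inr h))
        · exact Or.inl (Or.inr h)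
    · rcases h₁ hV with (h | h) | h
      · exact Or.inl (Or.inl (Or.inr h))
      · exact Or.inl (Or.inr h)
      · exact Or.inr (Or.inr h)

theorem SimpleLift.and_left {P : Program S} {A B : Goal S} {θ : Subst S} {A₁ : Goal S}
    (h : SimpleLift P A θ A₁) : SimpleLift P (.and A B) θ (.and A₁ (B.subst θ)) := by
  obtain ⟨A', h, rfl, hfv⟩ := h
  refine ⟨_, .andLeft B h, by simp [Exp.subst], ?_⟩
  rw [Exp.subst_id]
  exact Set.union_subset_union_left _ hfv

theorem SimpleLift.and_right {P : Program S} {A B : Goal S} {θ : Subst S} {A₁ : Goal S}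
    (h : SimpleLift P A θ A₁) : SimpleLift P (.and B A) θ (.and (B.subst θ) A₁) := by
  obtain ⟨A', h, rfl, hfv⟩ := h
  refine ⟨_, .andRight B h, by simp [Exp.subst], ?_⟩
  rw [Exp.subst_id]
  exact Set.union_subset_union_right _ hfv

theorem Exp.subst_single_subst_override {θ : Subst S} {V : Var} {B : Exp S [] V.1} {T : List Var}
    {ξ : ∀ V : Var, Exp S [] V.1} (h : IsPattern ξ T B (θ.toFun V)) {τ : ATy} {e : Exp S [] τ}
    (he : ∀ W ∈ T, W ∉ e.fv) :
    (e.subst (Subst.single V B)).subst (θ.override T ξ) = e.subst θ := by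
  rw [subst_subst]
  exact subst_congr fun W hW => Subst.single_comp_override h fun hT => he W hT hW

theorem TemplateLift.and_left {P : Program S} {F : Set Var} {A B : Goal S} {θ : Subst S}
    {A₁ : Goal S} (h : TemplateLift P F A θ A₁) (hB : B.fv ⊆ F) :
    TemplateLift P F (.and A B) θ (.and A₁ (B.subst θ)) := by
  obtain ⟨π, Q, C, T, ξ, hs, hC, hT, hξ, hp, hQ, hl⟩ := h
  refine ⟨π, Q, C, T, ξ, .andLeft B hs, hC, hT, hξ, hp, Or.inl hQ, ?_⟩
  rw [← Exp.subst_single_subst_override (V := (ATy.pred π, Q)) hp fun W hW h => hT W hW (hB h)]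
  exact hl.and_left

theorem TemplateLift.and_right {P : Program S} {F : Set Var} {A B : Goal S} {θ : Subst S}
    {A₁ : Goal S} (h : TemplateLift P F A θ A₁) (hB : B.fv ⊆ F) :
    TemplateLift P F (.and B A) θ (.and (B.subst θ) A₁) := by
  obtain ⟨π, Q, C, T, ξ, hs, hC, hT, hξ, hp, hQ, hl⟩ := h
  refine ⟨π, Q, C, T, ξ, .andRight B hs, hC, hT, hξ, hp, Or.inr hQ, ?_⟩
  rw [← Exp.subst_single_subst_override (V := (ATy.pred π, Q)) hp fun W hW h => hT W hW (hB h)]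
  exact hl.and_right

/-- A template step lifts when the predicate variable is an instance of one. -/
theorem stepLift_template {P : Program S} (K : Prop) {F : Set Var} (hF : F.Finite) {A : Goal S}
    (hA : A.fv ⊆ F) {θ : Subst S} (hθ : θ.IsBasic) {π : PTy} {Q : ℕ} {as : Args S π}
    {B : Exp S [] (ATy.pred π)} {T : List Var} (hB : IsTemplate B T)
    (h : A.subst θ = (Exp.fvar (ATy.pred π) Q).apps as) :
    StepLift P K F A θ (Subst.single (ATy.pred π, Q) B) []
      ((A.subst θ).subst (Subst.single (ATy.pred π, Q) B)) := by
  obtain ⟨E', as', rfl, hE', has⟩ := Exp.exists_apps_of_subst_eq hθ as h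
  obtain ⟨m, rfl, hm⟩ := Exp.subst_eq_fvar hE'
  -- The given template is not reused: its variables may clash with those of the lifted derivation.
  -- It is treated as a basic expression and given a fresh template of its own.
  obtain ⟨B', T', ξ, hB', hTF, hξ, hp⟩ := hB.isBasic.exists_template hB.ne_fvar hF
  set θ₁ := Subst.single (ATy.pred π, Q) B with hθ₁
  have hm' : (θ.comp θ₁).toFun (ATy.pred π, m) = B := by
    change (θ.toFun (ATy.pred π, m)).subst θ₁ = B
    rw [hm, hθ₁, Exp.subst_fvar_single]
  rw [← hm'] at hp
  have hb : θ₁.IsBasic := Subst.IsBasic.single hB.isBasic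
  refine ⟨_, T', [], _, (θ.comp θ₁).override T' ξ, .template m as' B' T' hB',
    Subst.IsBasic.single hB'.isBasic, (hθ.comp hb).override hξ, ?_, hTF, by simp, by simp,
    fun V hV _ => Subst.single_comp_override hp hV, ?_, fun _ => ?_, fun _ => ?_⟩
  · rw [Exp.subst_single_subst_override hp fun V hV h => hTF V hV (hA h), Exp.subst_subst]
  · refine (Subst.vars_single_subset _ _).trans (Set.union_subset_union ?_ hp.1)
    rw [Exp.fv_apps]
    exact Set.subset_union_left
  · intro V hV
    rcases Exp.fv_subst_single_subset _ hV with h | h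
    · exact Or.inl (Or.inl h.1)
    · exact Or.inl (Or.inr (hp.1 V h))
  · exact (Subst.dom_override_subset _ _ _).trans
      (Set.union_subset_union_left _ (Subst.dom_comp_subset _ _))

/-- Only the fact that `θ₁` is a zero-order unifier is used. Since `θθ₁` solves the lifted equation,
`μ(θθ₁) = θθ₁`, and `θθ₁` itself can serve as the new `θ'`. -/
theorem stepLift_eq {P : Program S} (K : Prop) (F : Set Var) {θ θ₁ : Subst S} (hθ : θ.IsBasic)
    {s t : Exp S [] ATy.i} (hθ₁ : θ₁.IsUnifier (s.subst θ) (t.subst θ)) :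
    StepLift P K F (.eq s t) θ θ₁ [] .one := by
  have hs : Solves (θ.comp θ₁) [(s, t)] := by
    intro p hp
    obtain rfl := List.mem_singleton.1 hp
    simpa [Exp.subst_subst] using hθ₁.2
  obtain ⟨μ, hμ⟩ := exists_isStrongMGU _ hs
  refine ⟨μ, [], [], _, θ.comp θ₁, .eq s t μ hμ.isMGU, hμ.zeroOrder.isBasic,
    hθ.comp hθ₁.1.isBasic, rfl, by simp, by simp, by simp, fun V _ _ => ?_, ?_, fun _ => ?_,
    fun _ => ?_⟩
  · rw [hμ.comp_eq _ hs]
  · refine hμ.vars_subset.trans ?_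
    rintro V ⟨p, hp, hV⟩
    obtain rfl := List.mem_singleton.1 hp
    exact Or.inl hV
  · simp [Exp.fv]
  · exact (Subst.dom_comp_subset _ _).trans Set.subset_union_left

/-- Under `K` the same variable is released, which is sound because `θ` does not move it. Otherwise
a fresh `m` is released, and `θ` is extended by sending `m` to the given variable. -/
theorem stepLift_ex {P : Program S} {K : Prop} {F : Set Var} (hF : F.Finite) {θ : Subst S}
    (hθ : θ.IsBasic) {ρ : ATy} {E : Exp S [ρ] ATy.o} {n : ℕ} (hE : E.fv ⊆ F)
    (hn : K → (ρ, n) ∉ θ.dom) :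
    StepLift P K F (.ex E) θ Subst.id [(ρ, n)] ((E.subst θ).inst1 (.fvar ρ n)) := by
  by_cases hK : K
  · have hn' : θ.toFun (ρ, n) = Exp.ofVar (ρ, n) := not_not.1 (hn hK)
    have hs : (E.inst1 (.fvar ρ n)).subst θ = (E.subst θ).inst1 (.fvar ρ n) := by
      rw [Exp.subst_inst1]
      congr 1
      exact (Exp.subst_ofVar θ (ρ, n)).trans hn'
    refine ⟨Subst.id, [], [(ρ, n)], _, θ, .ex E n, Subst.isBasic_id, hθ, hs, by simp, by simp,
      fun h => absurd hK h, by simp, by simp [Subst.vars_id], fun _ V hV => ?_, fun _ V hV => ?_⟩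
    · rcases Exp.fv_inst1_subset _ _ hV with h | h
      · exact Or.inl (Or.inl h)
      · obtain rfl : V = (ρ, n) := h
        -- As `θ` fixes the released variable, its occurrence in the lifted formula survives in the
        -- instance.
        refine Or.inr ?_
        rw [← hs, Exp.fv_subst]
        refine Set.mem_biUnion hV ?_
        rw [hn']
        rfl
    · exact Or.inl (Or.inl hV)
  · obtain ⟨m, hm⟩ := exists_fresh_var ρ hF
    refine ⟨Subst.id, [], [(ρ, m)], _,
      θ.override [(ρ, m)] (Subst.single (ρ, m) (Exp.ofVar (ρ, n))).toFun, .ex E m,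
      Subst.isBasic_id, hθ.override fun V hV => ?_, ?_, by simp, fun h => absurd h hK,
      fun _ V hV => ?_, fun V _ hV => ?_, by simp [Subst.vars_id], fun h => absurd h hK,
      fun h => absurd h hK⟩
    · obtain rfl := List.mem_singleton.1 hV
      rw [Subst.single_self]
      exact isBasic_ofVar (ρ, n)
    · rw [Exp.subst_inst1]
      congr 1
      · refine Exp.subst_congr fun V hV => Subst.override_of_notMem _ _ fun h => ?_
        obtain rfl := List.mem_singleton.1 h
        exact hm (hE hV)
      · rw [show (Exp.fvar ρ m : Exp S [] ρ) = Exp.ofVar (ρ, m) from rfl,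
          Exp.subst_ofVar _ (ρ, m), Subst.override_of_mem _ _ (List.mem_singleton_self _),
          Subst.single_self]
        rfl
    · obtain rfl := List.mem_singleton.1 hV
      exact hm
    · rw [Subst.id_comp, Subst.comp_id, Subst.override_of_notMem]
      exact hV.resolve_left hK

/-- An inserted template step is needed only for steps with the identity substitution and no
release. This is recorded in the second alternative, so that the conjunction rules can carry the two
lifted steps along together. -/
theorem Step.lift {P : Program S} {K : Prop} {A₀ A₁ : Goal S} {θ₁ : Subst S} {T R : List Var}
    (h : Step P A₀ θ₁ T R A₁) {F : Set Var} (hF : F.Finite) {θ : Subst S} (hθ : θ.IsBasic) :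
    ∀ {A : Goal S}, A.subst θ = A₀ → A.fv ⊆ F → (K → ∀ V ∈ R, V ∉ θ.dom) →
    StepLift P K F A θ θ₁ R A₁ ∨ θ₁ = Subst.id ∧ R = [] ∧ TemplateLift P F A θ A₁ := by
  have simple : ∀ {A A₁ : Goal S}, SimpleLift P A θ A₁ ∨ TemplateLift P F A θ A₁ →
      StepLift P K F A θ Subst.id [] A₁ ∨
        (Subst.id : Subst S) = Subst.id ∧ ([] : List Var) = [] ∧ TemplateLift P F A θ A₁ :=
    fun h => h.imp (fun h => h.stepLift hθ K F) fun h => ⟨rfl, rfl, h⟩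
  induction h with
  | clause C hC as =>
    intro A hA hAF _
    refine simple (lift_head hF hθ hAF hA nofun fun θ' E' as' hv hE' has => ?_)
    obtain ⟨n, rfl⟩ | rfl := Exp.subst_eq_pcon hE'
    · exact absurd rfl (hv n)
    refine ⟨_, .clause C hC as', ?_, ?_⟩
    · rw [Exp.subst_apps, Exp.subst_of_fv_eq_empty C.closed, has]
    · rw [Exp.fv_apps, Exp.fv_apps, C.closed]
      exact Set.union_subset_union_left _ (Set.empty_subset _)
  | template Q as B T hB =>
    intro A hA hAF _
    rw [← hA]
    exact Or.inl (stepLift_template K hF hAF hθ hB hA)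
  | beta E a as =>
    intro A hA hAF _
    refine simple (lift_head hF hθ hAF hA nofun fun θ' E' as' hv hE' has => ?_)
    obtain ⟨n, rfl⟩ | ⟨E, rfl, rfl⟩ := Exp.subst_eq_lam hE'
    · exact absurd rfl (hv n)
    cases as' with
    | cons a' as' =>
    cases has
    refine ⟨_, .beta E a' as', ?_, ?_⟩
    · rw [Exp.subst_apps, Exp.subst_inst1]
    · rw [Exp.fv_apps, Exp.fv_apps, Args.fv, ← Set.union_assoc]
      exact Set.union_subset_union_left _ (Exp.fv_inst1_subset _ _)
  | orLeft E₁ E₂ as =>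
    intro A hA hAF _
    refine simple (lift_head hF hθ hAF hA nofun fun θ' E' as' hv hE' has => ?_)
    obtain ⟨n, rfl⟩ | ⟨E₁, E₂, rfl, rfl, rfl⟩ := Exp.subst_eq_or hE'
    · exact absurd rfl (hv n)
    refine ⟨_, .orLeft E₁ E₂ as', ?_, ?_⟩
    · rw [Exp.subst_apps, has]
    · rw [Exp.fv_apps, Exp.fv_apps]
      exact Set.union_subset_union_left _ Set.subset_union_left
  | orRight E₁ E₂ as =>
    intro A hA hAF _
    refine simple (lift_head hF hθ hAF hA nofun fun θ' E' as' hv hE' has => ?_)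
    obtain ⟨n, rfl⟩ | ⟨E₁, E₂, rfl, rfl, rfl⟩ := Exp.subst_eq_or hE'
    · exact absurd rfl (hv n)
    refine ⟨_, .orRight E₁ E₂ as', ?_, ?_⟩
    · rw [Exp.subst_apps, has]
    · rw [Exp.fv_apps, Exp.fv_apps]
      exact Set.union_subset_union_left _ Set.subset_union_right
  | andApp hπ E₁ E₂ as =>
    intro A hA hAF _
    refine simple (lift_head hF hθ hAF hA nofun fun θ' E' as' hv hE' has => ?_)
    obtain ⟨n, rfl, -⟩ | ⟨E₁, E₂, rfl, rfl, rfl⟩ := Exp.subst_eq_and hE'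
    · exact absurd rfl (hv n)
    refine ⟨_, .andApp hπ E₁ E₂ as', ?_, ?_⟩
    · simp only [Exp.subst]
      rw [Exp.subst_apps, Exp.subst_apps, has]
    · simp only [Exp.fv, Exp.fv_apps]
      grind
  | andLeft B h ih =>
    intro A hA hAF hR
    obtain ⟨n, rfl, hn⟩ | ⟨A, B, rfl, rfl, rfl⟩ := Exp.subst_eq_and hA
    · exact absurd (hn ▸ hθ.toFun _) (not_isBasic_and _ _)
    rcases ih rfl (Set.subset_union_left.trans hAF) hR with h | ⟨rfl, rfl, h'⟩
    · exact Or.inl (h.and_left (Set.subset_union_right.trans hAF))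
    · rw [Exp.subst_id]
      exact Or.inr ⟨rfl, rfl, h'.and_left (Set.subset_union_right.trans hAF)⟩
  | andRight B h ih =>
    intro A hA hAF hR
    obtain ⟨n, rfl, hn⟩ | ⟨B, A, rfl, rfl, rfl⟩ := Exp.subst_eq_and hA
    · exact absurd (hn ▸ hθ.toFun _) (not_isBasic_and _ _)
    rcases ih rfl (Set.subset_union_right.trans hAF) hR with h | ⟨rfl, rfl, h'⟩
    · exact Or.inl (h.and_right (Set.subset_union_left.trans hAF))
    · rw [Exp.subst_id]
      exact Or.inr ⟨rfl, rfl, h'.and_right (Set.subset_union_left.trans hAF)⟩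
  | oneAnd A₀ =>
    intro A hA hAF _
    obtain ⟨n, rfl, hn⟩ | ⟨A, B, rfl, hA', rfl⟩ := Exp.subst_eq_and hA
    · exact absurd (hn ▸ hθ.toFun _) (not_isBasic_and _ _)
    refine simple ?_
    obtain ⟨n, rfl, hn⟩ | rfl := Exp.subst_eq_one hA'
    -- The conjunct `□` may come from a variable with the value `1`; the template `1`, without
    -- template variables, makes it explicit.
    · have hp : IsPattern (fun V => Exp.ofVar V) [] Exp.one (θ.toFun (ATy.o, n)) := by
        rw [hn]
        exact isPattern_closed _ rfl
      refine Or.inr ⟨PTy.o, n, .one, [], fun V => Exp.ofVar V,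
        .andLeft _ (.template n .nil .one [] .one), .one, by simp, by simp, hp, Or.inl rfl, ?_⟩
      rw [Exp.subst, Exp.subst_fvar_single]
      refine ⟨_, .oneAnd _, Exp.subst_single_subst_override hp (by simp), ?_⟩
      exact Set.subset_union_right
    · exact Or.inl ⟨_, .oneAnd B, rfl, Set.subset_union_right⟩
  | andOne A₀ =>
    intro A hA hAF _
    obtain ⟨n, rfl, hn⟩ | ⟨B, A, rfl, rfl, hA'⟩ := Exp.subst_eq_and hA
    · exact absurd (hn ▸ hθ.toFun _) (not_isBasic_and _ _)
    refine simple ?_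
    obtain ⟨n, rfl, hn⟩ | rfl := Exp.subst_eq_one hA'
    · have hp : IsPattern (fun V => Exp.ofVar V) [] Exp.one (θ.toFun (ATy.o, n)) := by
        rw [hn]
        exact isPattern_closed _ rfl
      refine Or.inr ⟨PTy.o, n, .one, [], fun V => Exp.ofVar V,
        .andRight _ (.template n .nil .one [] .one), .one, by simp, by simp, hp, Or.inr rfl, ?_⟩
      rw [Exp.subst, Exp.subst_fvar_single]
      refine ⟨_, .andOne _, Exp.subst_single_subst_override hp (by simp), ?_⟩
      exact Set.subset_union_left
    · exact Or.inl ⟨_, .andOne B, rfl, Set.subset_union_left⟩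
  | eq s t θ₁ hθ₁ =>
    intro A hA _ _
    obtain ⟨n, rfl, hn⟩ | ⟨s, t, rfl, rfl, rfl⟩ := Exp.subst_eq_eq hA
    · exact absurd (hn ▸ hθ.toFun _) (not_isBasic_eq _ _)
    exact Or.inl (stepLift_eq K F hθ hθ₁.1)
  | ex E n =>
    intro A hA hAF hR
    obtain ⟨m, rfl, hn⟩ | ⟨E, rfl, rfl⟩ := Exp.subst_eq_ex hA
    · exact absurd (hn ▸ hθ.toFun _) (not_isBasic_ex _)
    exact Or.inl (stepLift_ex hF hθ hAF fun hK => hR hK _ (List.mem_singleton_self _))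

/-! ### Lifting a refutation -/

/-- A refutation of `A`, with `U` the set of variables that appeared before, using a basic `δ` such
that `δγ` agrees with `θσ` except at the new variables. The template variables are not in `F`, nor
are the released variables, unless `K` holds. -/
def Lifts (P : Program S) (K : Prop) (F U : Set Var) (A : Goal S) (θ σ : Subst S) : Prop :=
  ∃ (δ γ : Subst S) (T R : List Var), Derivation P U A δ T R .one ∧ δ.IsBasic ∧ γ.IsBasic ∧
    (∀ V ∈ T, V ∉ F) ∧ (¬ K → ∀ V ∈ R, V ∉ F) ∧
    ∀ V, V ∉ T → K ∨ V ∉ R → (δ.comp γ).toFun V = (θ.comp σ).toFun V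

/-- The variables of `δ(V)` are `V` or belong to `δ`. The tail avoids those of `δ`, except for
releases under `K`, at which agreement holds anyway. So its agreement applies to `δ(V)`, giving
`δδ'γ = δθ'σ = θθ₁σ` at `V`. -/
theorem Lifts.cons {P : Program S} {K : Prop} {F U : Set Var} {A A' : Goal S}
    {δ θ θ₁ θ' σ : Subst S} {T R : List Var} (hs : Step P A δ T R A') (hδ : δ.IsBasic)
    (hT : ∀ V ∈ T, V ∉ U ∪ A.fv) (hR : ∀ V ∈ R, V ∉ U ∪ A.fv) (hTF : ∀ V ∈ T, V ∉ F)
    (hRF : ¬ K → ∀ V ∈ R, V ∉ F)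
    (heq : ∀ V, V ∉ T → K ∨ V ∉ R → (δ.comp θ').toFun V = (θ.comp θ₁).toFun V)
    (h : Lifts P K (F ∪ δ.vars) (U ∪ A.fv ∪ δ.vars) A' θ' σ) :
    Lifts P K F U A θ (θ₁.comp σ) := by
  obtain ⟨δ', γ, T', R', hd, hδ', hγ, hT', hR', heq'⟩ := h
  refine ⟨_, γ, _, _, .step hs hT hR hd, hδ.comp hδ', hγ, ?_, fun hK => ?_, fun V hVT hVR => ?_⟩
  · intro V hV
    rcases List.mem_append.1 hV with h | h
    · exact hTF V h
    · exact fun hF => hT' V h (Or.inl hF)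
  · intro V hV
    rcases List.mem_append.1 hV with h | h
    · exact hRF hK V h
    · exact fun hF => hR' hK V h (Or.inl hF)
  · simp only [List.mem_append, not_or] at hVT hVR
    have h₁ : (δ.toFun V).subst (δ'.comp γ) = (δ.toFun V).subst (θ'.comp σ) := by
      refine Exp.subst_congr fun W hW => ?_
      rcases δ.fv_toFun_subset V hW with h | h
      · obtain rfl : W = V := h
        exact heq' W hVT.2 (hVR.imp_right And.right)
      · refine heq' W (fun hW => hT' W hW (Or.inr h)) ?_
        by_cases hK : K
        · exact Or.inl hK
        · exact Or.inr fun hW => hR' hK W hW (Or.inr h)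
    rw [Subst.comp_assoc, ← Subst.comp_assoc θ]
    change (δ.toFun V).subst (δ'.comp γ) = ((θ.comp θ₁).toFun V).subst σ
    rw [h₁, ← heq V hVT.1 (hVR.imp_right And.left), ← Exp.subst_subst]
    rfl

theorem lifts_one (P : Program S) (K : Prop) (F U : Set Var) {θ : Subst S} (hθ : θ.IsBasic) :
    Lifts P K F U .one θ Subst.id :=
  ⟨Subst.id, θ, [], [], .refl U _, Subst.isBasic_id, hθ, by simp, by simp, by simp⟩

/-- The set `W` collects the variables that the lifted derivation may contain although the given one
has not shown them: initially those of the goal and of `θ`, later also the inserted template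
variables. By the last hypothesis, a variable that is new in the given derivation and outside `W` is
new in the lifted one and not moved by `θ`, so it can be released there too. `F` contains all future
releases, so that template variables never anticipate them. -/
theorem Derivation.lift {P : Program S} {K : Prop} {U₀ : Set Var} {A₀ A₁ : Goal S} {σ : Subst S}
    {T R : List Var} (h : Derivation P U₀ A₀ σ T R A₁) (hA₁ : A₁ = .one) :
    ∀ {A : Goal S} {θ : Subst S} {F U W : Set Var}, θ.IsBasic → A.subst θ = A₀ → F.Finite →
    U.Finite → (∀ V ∈ R, V ∈ F) → (K → ∀ V ∈ R, V ∉ W) →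
    (K → U ∪ A.fv ∪ θ.dom ⊆ U₀ ∪ A₀.fv ∪ W) → Lifts P K F U A θ σ := by
  induction h with
  | refl U₀ A₀ =>
    intro A θ F U W hθ hA _ _ _ _ _
    rw [hA₁] at hA
    obtain ⟨n, rfl, hn⟩ | rfl := Exp.subst_eq_one hA
    -- The final `□` may be the value of a variable; one more template step then ends the
    -- refutation.
    · have hs := Step.template (P := P) n .nil .one [] .one
      simp only [Exp.apps, Exp.subst_fvar_single] at hs
      rw [← Subst.id_comp (Subst.id : Subst S)]
      refine Lifts.cons hs (Subst.IsBasic.single .one) (by simp) (by simp) (by simp) (by simp)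
        (fun V _ _ => ?_) (lifts_one P K _ _ hθ)
      rw [Subst.comp_id, Subst.single_comp_of_eq]
      exact hn
    · exact lifts_one P K F U hθ
  | @step U₀ A₀ A₁ _ θ₁ σ' T₁ _ R₁ R' hs _ hR h' ih =>
    intro A θ F U W hθ hA hF hU hRF hRW hinv
    have hAfin := A.fv_finite
    have hRnew : K → ∀ V ∈ R₁, V ∉ U ∪ A.fv ∪ θ.dom := by
      intro hK V hV h
      rcases hinv hK h with h | h
      · exact hR V hV h
      · exact hRW hK V (List.mem_append_left _ hV) h
    have hRF' : ∀ V ∈ R', V ∈ F := fun V hV => hRF V (List.mem_append_right _ hV)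
    have hRW' : K → ∀ V ∈ R', V ∉ W := fun hK V hV => hRW hK V (List.mem_append_right _ hV)
    rcases hs.lift (K := K) (F := F ∪ (U ∪ A.fv)) (hF.union (hU.union hAfin)) hθ hA
        (fun V hV => Or.inr (Or.inr hV)) (fun hK V hV h => hRnew hK V hV (Or.inr h)) with
      ⟨δ, T', R'', A', θ', hs', hδ, hθ', hA', hT', hRK, hRnK, heq, hvars, hfv, hdom⟩ |
      ⟨rfl, rfl, π, Q, B, T', ξ, hs', hB, hT', hξ, hp, hQ, A', hs'', hA', hfv⟩
    · refine Lifts.cons hs' hδ (fun V hV h => hT' V hV (Or.inr h)) ?_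
        (fun V hV h => hT' V hV (Or.inl h)) (fun hK V hV h => hRnK hK V hV (Or.inl h)) heq ?_
      · intro V hV h
        by_cases hK : K
        · exact hRnew hK V (hRK hK ▸ hV) (Or.inl h)
        · exact hRnK hK V hV (Or.inr h)
      -- Adding `T'` to `W` is harmless, since `T'` avoids `F` and hence the remaining releases.
      · refine ih hA₁ (W := W ∪ {V | V ∈ T'}) hθ' hA' (hF.union δ.vars_finite)
          ((hU.union hAfin).union δ.vars_finite) (fun V hV => Or.inl (hRF' V hV)) ?_ ?_
        · rintro hK V hV (h | h)
          · exact hRW' hK V hV h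
          · exact hT' V h (Or.inl (hRF' V hV))
        · intro hK
          have h₁ := hinv hK
          have h₂ := hfv hK
          have h₃ := hdom hK
          have h₄ : θ₁.dom ⊆ θ₁.vars := Set.subset_union_left
          grind
    · have hvars : (Subst.single (ATy.pred π, Q) B).vars ⊆ A.fv ∪ {V | V ∈ T'} :=
        (Subst.vars_single_subset (ATy.pred π, Q) B).trans
          (Set.union_subset_union (Set.singleton_subset_iff.2 hQ) hp.1)
      have hfv' : (A.subst (Subst.single (ATy.pred π, Q) B)).fv ⊆ A.fv ∪ {V | V ∈ T'} := by
        intro V hV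
        rcases Exp.fv_subst_single_subset _ hV with h | h
        · exact Or.inl h.1
        · exact Or.inr (hp.1 V h)
      -- One given step becomes two lifted ones; the additional identity is matched with the
      -- template step.
      rw [← Subst.id_comp (Subst.id.comp σ')]
      refine Lifts.cons hs' (Subst.IsBasic.single hB.isBasic)
        (fun V hV h => hT' V hV (Or.inr h)) (by simp) (fun V hV h => hT' V hV (Or.inl h)) (by simp)
        (θ' := θ.override T' ξ) (fun V hV _ => ?_) ?_
      · rw [Subst.comp_id, Subst.single_comp_override hp hV]
      refine Lifts.cons hs'' Subst.isBasic_id (by simp) (by simp) (by simp) (by simp)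
        (θ' := θ.override T' ξ) (fun V _ _ => by simp) ?_
      refine ih hA₁ (W := W ∪ {V | V ∈ T'}) (hθ.override hξ) hA'
        ((hF.union (Subst.vars_finite _)).union (Subst.vars_finite _))
        ((((hU.union hAfin).union (Subst.vars_finite _)).union (Exp.fv_finite _)).union
          (Subst.vars_finite _)) (fun V hV => Or.inl (Or.inl (hRF' V hV))) ?_ ?_
      · rintro hK V hV (h | h)
        · exact hRW' hK V hV h
        · exact hT' V h (Or.inl (hRF' V hV))
      · intro hK
        have h₁ := hinv hK
        have h₂ := Subst.dom_override_subset θ T' ξ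
        rw [Subst.vars_id]
        grind

end HOLP

-- The Lifting Lemma

theorem mainTheorem6 {S : HOLP.Signature.{u, v}} (P : HOLP.Program S) (G : HOLP.Goal S)
    (θ : HOLP.Subst S) (hθ : θ.IsBasic) (σ : HOLP.Subst S) (T R : List HOLP.Var)
    (h : HOLP.IsRefutation P (G.subst θ) σ T R) :
    ∃ (δ γ : HOLP.Subst S) (T' R' : List HOLP.Var),
      HOLP.IsRefutation P G δ T' R' ∧ δ.IsBasic ∧ γ.IsBasic ∧
      (G.subst δ).subst γ = (G.subst θ).subst σ ∧
      (θ.comp σ).bindings ⊆ (δ.comp γ).bindings ∧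
      (∀ b ∈ (δ.comp γ).bindings \ (θ.comp σ).bindings, b.1 ∈ T' ∨ b.1 ∈ R') ∧
      ((∀ V ∈ R, V ∉ G.fv ∧ V ∉ θ.vars) →
        ∀ b ∈ (δ.comp γ).bindings \ (θ.comp σ).bindings, b.1 ∈ T') := by
  -- Forbidding `G.fv` gives the equation between the instances of `G`; forbidding the domain of
  -- `θσ` keeps every binding of `θσ`.
  obtain ⟨δ, γ, T', R', hd, hδ, hγ, hT', hR', heq⟩ := HOLP.Derivation.lift
    (K := ∀ V ∈ R, V ∉ G.fv ∧ V ∉ θ.vars) h rfl (A := G)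
    (F := {V | V ∈ R} ∪ (G.fv ∪ (θ.comp σ).dom)) (U := ∅) (W := G.fv ∪ θ.vars) hθ rfl
    (R.finite_toSet.union (G.fv_finite.union (θ.comp σ).finite_dom)) Set.finite_empty
    (fun V hV => Or.inl hV) (fun hK V hV h => h.elim (hK V hV).1 (hK V hV).2) (by
      rintro - V ((h | h) | h)
      · exact h.elim
      · exact Or.inr (Or.inl h)
      · exact Or.inr (Or.inr (Or.inl h)))
  have old : ∀ V ∈ G.fv ∪ (θ.comp σ).dom, (δ.comp γ).toFun V = (θ.comp σ).toFun V := by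
    intro V hV
    refine heq V (fun h => hT' V h (Or.inr hV)) ?_
    by_cases hK : ∀ V ∈ R, V ∉ G.fv ∧ V ∉ θ.vars
    · exact Or.inl hK
    · exact Or.inr fun h => hR' hK V h (Or.inr hV)
  -- A binding of `δγ` that is missing from `θσ` marks a variable at which the two differ, and this
  -- can only be an introduced one.
  have new : ∀ b ∈ (δ.comp γ).bindings \ (θ.comp σ).bindings,
      (δ.comp γ).toFun b.1 ≠ (θ.comp σ).toFun b.1 := by
    rintro b ⟨⟨h₁, h₂⟩, h₃⟩ h
    refine h₃ ⟨?_, h₂.trans h⟩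
    change (θ.comp σ).toFun b.1 ≠ _
    exact h ▸ h₁
  refine ⟨δ, γ, T', R', hd, hδ, hγ, ?_, ?_, ?_, ?_⟩
  · rw [HOLP.Exp.subst_subst, HOLP.Exp.subst_subst]
    exact HOLP.Exp.subst_congr fun V hV => old V (Or.inl hV)
  · rintro b ⟨h₁, h₂⟩
    have h := old b.1 (Or.inr h₁)
    refine ⟨?_, h₂.trans h.symm⟩
    change (δ.comp γ).toFun b.1 ≠ _
    exact h ▸ h₁
  · intro b hb
    by_contra! hn
    exact new b hb (heq b.1 hn.1 (Or.inr hn.2))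
  · intro hK b hb
    by_contra hn
    exact new b hb (heq b.1 hn (Or.inl hK))
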